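/- **Setting.** Let $d,K,T\ge 1$, let $\mathcal X$ be a finite set with $|\mathcal X|=S$, let $\mathcal G$ be a probability distribution on $\mathcal X$, and let $L\ge S$ be such that $g(x):=\mathcal G(\{x\})\ge 1/L$ for all $x\in\mathcal X$. Let $\phi:[K]\times\mathcal X\to\mathcal Z\subset\mathbb R^d$ be a feature map and $\theta_0\in\Theta\subset\mathbb R^d$, with $|\langle z,\theta\rangle|\le 1$ for all $z\in\mathcal Z$, $\theta\in\Theta$. For a family $p=(p_x)_{x\in\mathcal X}$ of distributions over $[K]$ put $\Sigma(p)=\sum_{x}g(x)\sum_{a}p_x(a)\,\phi(a,x)\phi(a,x)^\top$. Assume that $\lambda>0$ and a family $e^*=(e^*_x)_x$ of distributions over $[K]$ are such that $\Sigma(e^*)$ is invertible and $z^\top\Sigma(e^*)^{-1}z\le 1/\lambda$ for all $z\in\mathcal Z$. **Protocol.** In round $t=1,\dots,T$ a context $X_t\sim\mathcal G$, independent of the history $\mathcal F_{t-1}=\sigma\big((X_s,A_s,\ell_s(A_s,X_s)):s<t\big)$, is observed, an arm $A_t\in[K]$ is played, and the loss $\ell_t(A_t,X_t)$ is incurred and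 observed, where $\ell_t(a,x)=\langle\phi(a,x),\theta_0\rangle+\varepsilon_t(a)$ with $\mathbb E[\varepsilon_t(a)\mid X_t,\mathcal F_{t-1}]=0$ and, almost surely, $|\ell_t(a,x)|\le 1$ for all $a,x,t$. The regret is $$R_T=\max_{\rho:\mathcal X\to[K]}\mathbb E\Big[\sum_{t=1}^T\big(\ell_t(A_t,X_t)-\ell_t(\rho(X_t),X_t)\big)\Big].$$ **Algorithm ($1/2$-LC-Tsallis-INF).** Let $\eta_t=\min\big\{K^{1/4}/\sqrt{dt},\ \tfrac1{16}\sqrt{\lambda/L}\big\}$ for $t\ge 1$, $1/\eta_0:=0$, $\gamma_t=128L\eta_t^2/\lambda$ and $\psi(p)=2\big(1-\sum_a\sqrt{p(a)}\big)$. Given $\mathcal F_{t-1}$, the arm $A_t$ is drawn from $\pi_t(\cdot\mid X_t)$, by a randomization independent of the noise of round $t$, where $\pi_t(x)=(1-\gamma_t)q_t(x)+\gamma_te^*_x$ and $$q_t(x)\in\operatorname*{arg\,min}_{p}\Big\{\sum_{s=1}^{t-1}\sum_{a}\langle\widehat\theta_s,\phi(a,x)\rangle p(a)+\frac1{\eta_{t-1}}\psi(p)\Big\},\qquad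 \widehat\theta_s=\Sigma(\pi_s)^{-1}\phi(A_s,X_s)\,\ell_s(A_s,X_s),$$ with $p$ ranging over the distributions on $[K]$ ($q_1$ is an arbitrary non-random choice). **Margin condition.** Let $\rho^*_T$ minimize $\mathbb E\big[\sum_{t=1}^T\langle\phi(\rho(X_t),X_t),\theta_0\rangle\big]$ over $\rho:\mathcal X\to[K]$, and let $\Delta(x)=\min_{a\ne\rho^*_T(x)}\langle\phi(a,x)-\phi(\rho^*_T(x),x),\theta_0\rangle$ (which is $+\infty$ if $K=1$). Assume that $\Delta_*>0$ and $\beta\in(0,\infty]$ are such that, for $X\sim\mathcal G$, $$\mathbb P\big(\Delta(X)\le h\big)\le\tfrac12\,(h/\Delta_*)^{\beta}\quad\text{for all }h\in[0,\Delta_*];$$ for $\beta=\infty$ this is read as $\mathbb P(\Delta(X)<\Delta_*)=0$. **Theorem.** There is a universal constant $C>0$, independent of all the quantities above, such that, with $$\kappa=\sqrt{\frac{KL}{\lambda}}+\frac{\sqrt K\,L}{\lambda d}\log T ,$$ if $\beta<\infty$ then $$R_T\le C\left(\Big(\frac{1+\beta}{\beta\Delta_*}\Big)^{\frac{\beta}{2+\beta}}\big(Ld\sqrt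 K\log T\big)^{\frac{1+\beta}{2+\beta}}\,T^{\frac1{2+\beta}}+\kappa\right),$$ and if $\beta=\infty$ then $$R_T\le C\left(\frac{Ld\sqrt K\log T}{\Delta_*}+\kappa\right).$$ -/

import Mathlib

open MeasureTheory ProbabilityTheory
open scoped ENNReal Matrix

noncomputable section

namespace LinearContextualBandit

/-- A linear contextual bandit with context space `𝒳`, feature dimension `d` and arms `Fin K`, in the
stochastic regime: the regression coefficient is the same vector `θ₀` in every round. -/
structure Problem (𝒳 : Type*) [MeasurableSpace 𝒳] (d K : ℕ) where
  /-- the distribution of the contexts -/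
  G : Measure 𝒳
  /-- the (known) feature map -/
  φ : Fin K → 𝒳 → Fin d → ℝ
  /-- the feature space -/
  Z : Set (Fin d → ℝ)
  /-- the parameter space -/
  Θ : Set (Fin d → ℝ)
  /-- the regression coefficient -/
  θ₀ : Fin d → ℝ
  isProbabilityMeasure_G : IsProbabilityMeasure G
  φ_mem : ∀ a x, φ a x ∈ Z
  θ₀_mem : θ₀ ∈ Θ
  abs_dotProduct_le_one : ∀ z ∈ Z, ∀ θ ∈ Θ, |z ⬝ᵥ θ| ≤ 1

variable {𝒳 Ω : Type*} [MeasurableSpace 𝒳] [MeasurableSpace Ω] {d K : ℕ}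

/-! ### Contexts, covariance matrices, exploration policy -/

/-- The probability mass `g(x)` of the context `x`. -/
def Problem.g (P : Problem 𝒳 d K) (x : 𝒳) : ℝ := P.G.real {x}

/-- `Σ(p) = E_{X₀ ∼ G, a ∼ p(X₀)} [φ(a, X₀) φ(a, X₀)ᵀ]`, for a finite context space. -/
def Problem.cov [Fintype 𝒳] (P : Problem 𝒳 d K) (p : 𝒳 → Fin K → ℝ) :
    Matrix (Fin d) (Fin d) ℝ :=
  ∑ x, P.g x • ∑ a, p x a • Matrix.vecMulVec (P.φ a x) (P.φ a x)

/-- The context space is finite, of size at most `L`, and each context has mass at least `1 / L`. -/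
def Problem.FiniteSupport [Fintype 𝒳] (P : Problem 𝒳 d K) (L : ℝ) : Prop :=
  (Fintype.card 𝒳 : ℝ) ≤ L ∧ ∀ x, 1 / L ≤ P.g x

/-- `e` is an exploration policy with parameter `lam`: each `e x` is a distribution over the arms, the
matrix `Σ(e)` is invertible, and `zᵀ Σ(e)⁻¹ z ≤ 1 / lam` on the feature space. -/
structure Problem.IsExplorationPolicy [Fintype 𝒳] (P : Problem 𝒳 d K) (lam : ℝ)
    (e : 𝒳 → Fin K → ℝ) : Prop where
  lam_pos : 0 < lam
  mem_simplex : ∀ x, e x ∈ stdSimplex ℝ (Fin K)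
  isUnit_cov : IsUnit (P.cov e)
  le_inv_lam : ∀ z ∈ P.Z, z ⬝ᵥ ((P.cov e)⁻¹ *ᵥ z) ≤ 1 / lam

/-! ### Losses, history, regret

A run of `T` rounds `t = 1, …, T` is given by random variables on `Ω`: contexts `X t`, arms `A t` and
noises `ε t a`. -/

/-- The loss `ℓ_t(a, x) = ⟨φ(a, x), θ₀⟩ + ε_t(a)`. -/
def Problem.loss (P : Problem 𝒳 d K) (ε : ℕ → Fin K → Ω → ℝ) (t : ℕ) (a : Fin K) (x : 𝒳)
    (ω : Ω) : ℝ :=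
  P.φ a x ⬝ᵥ P.θ₀ + ε t a ω

/-- The σ-algebra `ℱ_t` generated by the observations `(X_s, A_s, ℓ_s(A_s, X_s))`, `s = 1, …, t`. -/
abbrev Problem.history (P : Problem 𝒳 d K) (X : ℕ → Ω → 𝒳) (A : ℕ → Ω → Fin K)
    (ε : ℕ → Fin K → Ω → ℝ) (t : ℕ) : MeasurableSpace Ω :=
  ⨆ s ∈ Finset.Icc 1 t, MeasurableSpace.comap
    (fun ω => (X s ω, A s ω, P.loss ε s (A s ω) (X s ω) ω)) inferInstance

/-- The environment in the stochastic regime, over the rounds `1, …, T`: contexts are drawn from `G`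
independently of the history, the noise has mean zero given the context and the history, and all
losses lie in `[-1, 1]`. -/
structure Problem.IsStochasticEnvironment (P : Problem 𝒳 d K) (μ : Measure Ω) (T : ℕ)
    (X : ℕ → Ω → 𝒳) (A : ℕ → Ω → Fin K) (ε : ℕ → Fin K → Ω → ℝ) : Prop where
  measurable_X : ∀ t ∈ Finset.Icc 1 T, Measurable (X t)
  measurable_A : ∀ t ∈ Finset.Icc 1 T, Measurable (A t)
  measurable_ε : ∀ t ∈ Finset.Icc 1 T, ∀ a, Measurable (ε t a)
  law_X : ∀ t ∈ Finset.Icc 1 T, μ.map (X t) = P.G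
  indep_X : ∀ t ∈ Finset.Icc 1 T,
    Indep (MeasurableSpace.comap (X t) inferInstance) (P.history X A ε (t - 1)) μ
  noise_mean_zero : ∀ t ∈ Finset.Icc 1 T, ∀ a,
    μ[ε t a | P.history X A ε (t - 1) ⊔ MeasurableSpace.comap (X t) inferInstance] =ᵐ[μ] 0
  loss_bounded : ∀ t ∈ Finset.Icc 1 T, ∀ a x, ∀ᵐ ω ∂μ, |P.loss ε t a x ω| ≤ 1

/-- The regret `R_T = max_ρ E [∑_{t ≤ T} (ℓ_t(A_t, X_t) - ℓ_t(ρ(X_t), X_t))]` over all `ρ : 𝒳 → [K]`. -/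
def Problem.regret (P : Problem 𝒳 d K) (μ : Measure Ω) (T : ℕ)
    (X : ℕ → Ω → 𝒳) (A : ℕ → Ω → Fin K) (ε : ℕ → Fin K → Ω → ℝ) : ℝ :=
  ⨆ ρ : 𝒳 → Fin K, ∫ ω, ∑ t ∈ Finset.Icc 1 T,
    (P.loss ε t (A t ω) (X t ω) ω - P.loss ε t (ρ (X t ω)) (X t ω) ω) ∂μ

/-! ### Optimal policy, suboptimality gap, margin condition -/

/-- `ρ` is an optimal policy `ρ*_T`: it minimizes `E [∑_{t ≤ T} ⟨φ(ρ(X_t), X_t), θ₀⟩]`. -/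
def Problem.IsOptimalPolicy (P : Problem 𝒳 d K) (μ : Measure Ω) (T : ℕ)
    (X : ℕ → Ω → 𝒳) (ρ : 𝒳 → Fin K) : Prop :=
  ∀ ρ' : 𝒳 → Fin K,
    ∫ ω, ∑ t ∈ Finset.Icc 1 T, P.φ (ρ (X t ω)) (X t ω) ⬝ᵥ P.θ₀ ∂μ ≤
      ∫ ω, ∑ t ∈ Finset.Icc 1 T, P.φ (ρ' (X t ω)) (X t ω) ⬝ᵥ P.θ₀ ∂μ

/-- The suboptimality gap `Δ(x) = min_{a ≠ ρ(x)} (⟨φ(a, x), θ₀⟩ - ⟨φ(ρ(x), x), θ₀⟩)`, which is `+∞`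
when there is only one arm. -/
def Problem.gap (P : Problem 𝒳 d K) (ρ : 𝒳 → Fin K) (x : 𝒳) : EReal :=
  ⨅ a : {a : Fin K // a ≠ ρ x}, ((P.φ a.1 x ⬝ᵥ P.θ₀ - P.φ (ρ x) x ⬝ᵥ P.θ₀ : ℝ) : EReal)

/-- The margin condition `P(Δ(X) ≤ h) ≤ ½ (h / Δ_*)^β` for `h ∈ [0, Δ_*]`, with `β ∈ (0, ∞]`.
For `β = ∞` it means `Δ(X) ≥ Δ_*` almost surely. -/
structure Problem.MarginCondition (P : Problem 𝒳 d K) (ρ : 𝒳 → Fin K) (Δs : ℝ) (β : ℝ≥0∞) :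
    Prop where
  Δs_pos : 0 < Δs
  β_pos : 0 < β
  finite : β ≠ ⊤ → ∀ h ∈ Set.Icc 0 Δs,
    P.G.real {x | P.gap ρ x ≤ (h : EReal)} ≤ 1 / 2 * (h / Δs) ^ β.toReal
  infinite : β = ⊤ → P.G {x | P.gap ρ x < (Δs : EReal)} = 0

/-! ### The algorithm -/

/-- The learning rate `η_t = min {K^{1/4} / √(d t), (1/16) √(lam / L)}`. -/
def learningRate (d K : ℕ) (L lam : ℝ) (t : ℕ) : ℝ :=
  min ((K : ℝ) ^ (1 / 4 : ℝ) / √((d : ℝ) * t)) (1 / 16 * √(lam / L))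

/-- `1 / η_t`, with the convention `1 / η_0 = 0`. -/
def invLearningRate (d K : ℕ) (L lam : ℝ) (t : ℕ) : ℝ :=
  if t = 0 then 0 else 1 / learningRate d K L lam t

/-- The exploration rate `γ_t = 128 L η_t² / lam`. -/
def explorationRate (d K : ℕ) (L lam : ℝ) (t : ℕ) : ℝ :=
  128 * L * learningRate d K L lam t ^ 2 / lam

/-- The regularizer `ψ(q) = (1/α) (1 - ∑_a q(a)^α)`. -/
def tsallis (α : ℝ) (q : Fin K → ℝ) : ℝ := 1 / α * (1 - ∑ a, q a ^ α)

/-- The played policy `π_t(a | x) = (1 - γ_t) q_t(a | x) + γ_t e(a | x)`, where `q t ω x a` is the value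
of `q_t(a | x)` at the outcome `ω`. -/
def policy (L lam : ℝ) (d : ℕ) (e : 𝒳 → Fin K → ℝ) (q : ℕ → Ω → 𝒳 → Fin K → ℝ) (t : ℕ) (ω : Ω)
    (x : 𝒳) (a : Fin K) : ℝ :=
  (1 - explorationRate d K L lam t) * q t ω x a + explorationRate d K L lam t * e x a

/-- The estimator `θ̂_t = Σ_t⁻¹ φ(A_t, X_t) ℓ_t(A_t, X_t)`, where `Σ_t = Σ(π_t)`. -/
def Problem.estimator [Fintype 𝒳] (P : Problem 𝒳 d K) (L lam : ℝ) (e : 𝒳 → Fin K → ℝ)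
    (q : ℕ → Ω → 𝒳 → Fin K → ℝ) (X : ℕ → Ω → 𝒳) (A : ℕ → Ω → Fin K) (ε : ℕ → Fin K → Ω → ℝ)
    (t : ℕ) (ω : Ω) : Fin d → ℝ :=
  P.loss ε t (A t ω) (X t ω) ω •
    ((P.cov (policy L lam d e q t ω))⁻¹ *ᵥ P.φ (A t ω) (X t ω))

/-- The FTRL objective `p ↦ ∑_{s < t} ⟨ℓ̂_s(x), p⟩ + (1 / η_{t-1}) ψ(p)` in round `t` at the context `x`,
where `ℓ̂_s(a, x) = ⟨θ̂_s, φ(a, x)⟩`. -/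
def Problem.ftrlObjective [Fintype 𝒳] (P : Problem 𝒳 d K) (α L lam : ℝ) (e : 𝒳 → Fin K → ℝ)
    (q : ℕ → Ω → 𝒳 → Fin K → ℝ) (X : ℕ → Ω → 𝒳) (A : ℕ → Ω → Fin K) (ε : ℕ → Fin K → Ω → ℝ)
    (t : ℕ) (ω : Ω) (x : 𝒳) (p : Fin K → ℝ) : ℝ :=
  ∑ s ∈ Finset.Icc 1 (t - 1), ∑ a, (P.estimator L lam e q X A ε s ω ⬝ᵥ P.φ a x) * p a +
    invLearningRate d K L lam (t - 1) * tsallis α p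

/-- In the rounds `1, …, T` the arms `A t` are played by the `α`-LC-Tsallis-INF with exploration policy
`e`: `q_t` is determined by the past observations and minimizes the FTRL objective over the probability
simplex, and `A t` is drawn from `π_t(X_t)` (by a randomization that does not look at the losses of
the round). In round `1`, where the objective vanishes, `q_1` is any fixed choice. -/
structure Problem.PlaysLCTsallisINF [Fintype 𝒳] (P : Problem 𝒳 d K) (α L lam : ℝ)
    (e : 𝒳 → Fin K → ℝ) (μ : Measure Ω) (T : ℕ) (q : ℕ → Ω → 𝒳 → Fin K → ℝ)
    (X : ℕ → Ω → 𝒳) (A : ℕ → Ω → Fin K) (ε : ℕ → Fin K → Ω → ℝ) : Prop where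
  adapted : ∀ t ∈ Finset.Icc 1 T, ∀ x a,
    Measurable[P.history X A ε (t - 1)] (fun ω => q t ω x a)
  mem_simplex : ∀ t ∈ Finset.Icc 1 T, ∀ ω x, q t ω x ∈ stdSimplex ℝ (Fin K)
  isMinOn : ∀ t ∈ Finset.Icc 1 T, ∀ ω x,
    IsMinOn (P.ftrlObjective α L lam e q X A ε t ω x) (stdSimplex ℝ (Fin K)) (q t ω x)
  sampling : ∀ t ∈ Finset.Icc 1 T, ∀ a,
    μ[(A t ⁻¹' {a}).indicator (fun _ => (1 : ℝ)) |
        P.history X A ε (t - 1) ⊔ MeasurableSpace.comap (X t) inferInstance ⊔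
          ⨆ b, MeasurableSpace.comap (ε t b) inferInstance]
      =ᵐ[μ] fun ω => policy L lam d e q t ω (X t ω) a

/-- `κ = √(K L / lam) + (√K L / (lam d)) log T`. -/
def kappa (d K : ℕ) (L lam : ℝ) (T : ℕ) : ℝ :=
  √(K * L / lam) + √K * L / (lam * d) * Real.log T

end LinearContextualBandit

end

set_option linter.unusedSectionVars false

namespace LinearContextualBandit

/-! ### The `1/2`-Tsallis entropy and follow-the-regularized-leader -/

/-! The proof is a self-bounding argument. Let `ρ` be the optimal policy, `S` the sum over rounds of
the expected suboptimality of `π_t` against `ρ`, which dominates the regret, and `Q` the sum of the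
expected probabilities that an arm drawn from `q_t` deviates from `ρ`. Two bounds relate `S` and
`Q`, with `D = L d √K log T`.

Upper bound, `S ≤ 768 κ + (h / 8) Q + 800 D / h` for every `h > 0` (`upper_bound`). FTRL is run
separately in each context on unbiased loss estimates. For the `1/2`-Tsallis entropy, both the
stability and the penalty terms carry a factor `√(1 - q_t(ρ(x) | x))` (`stability_tsallis`,
`neg_tsallis_le`). Averaging over contexts, the trace identity `tr(Σ⁻¹ Σ) = d` and `g ≥ 1 / L` bound
the weighted variance by `d √L` times the square root of the deviation (`sum_sqrt_mul_invForm_le`).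
Round `t` then costs about `√(d L) K^{1/4} / √t` times the expected square root of the deviation,
and Young's inequality with the harmonic sum gives the claim. Stability needs `√q |ℓ̂|` to be small
against `1 / η`. This follows from multiplying `q φᵀ Σ⁻¹ φ ≤ 2 L` by the bound on `φᵀ Σ⁻¹ φ` due to
forced exploration, and it dictates the size of `γ_t`.

Lower bound, `(h / 2) (Q - T · P(Δ(X) ≤ h)) ≤ S` (`lower_bound`): outside the contexts of small gap
every deviation costs at least `h`, and `π_t ≥ q_t / 2`.

Since `h / 8` is a quarter of `h / 2`, the term in `Q` is absorbed into `S / 4` plus a margin term.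
The threshold `h` is then chosen to balance `D / h` against `h T (h / Δ_*)^β` (`selfBounding_le`);
for `β = ∞` it is `Δ_*`. -/

lemma tsallis_half {K : ℕ} (p : Fin K → ℝ) : tsallis (1 / 2) p = 2 * (1 - ∑ a, √(p a)) := by
  simp only [tsallis, Real.sqrt_eq_rpow]
  norm_num

/-- With `u = √x` and `v = √y` the gap is `(v - u)² v (v + 2u) / (2u³)`. The quadratic error term is
valid for every `y ≥ 0`, so first-order optimality can be tested without derivatives. -/
lemma sqrt_lower_bound {x y : ℝ} (hx : 0 < x) (hy : 0 ≤ y) :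
    √x + (y - x) / (2 * √x) - (y - x) ^ 2 / (2 * (x * √x)) ≤ √y := by
  obtain ⟨u, hu, rfl⟩ : ∃ u, 0 < u ∧ x = u ^ 2 := ⟨√x, Real.sqrt_pos.2 hx, (Real.sq_sqrt hx.le).symm⟩
  obtain ⟨v, hv, rfl⟩ : ∃ v, 0 ≤ v ∧ y = v ^ 2 := ⟨√y, Real.sqrt_nonneg _, (Real.sq_sqrt hy).symm⟩
  rw [Real.sqrt_sq hu.le, Real.sqrt_sq hv]
  have key : v - (u + (v ^ 2 - u ^ 2) / (2 * u) - (v ^ 2 - u ^ 2) ^ 2 / (2 * (u ^ 2 * u)))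
      = (v - u) ^ 2 * (v * (v + 2 * u)) / (2 * u ^ 3) := by
    field_simp
    ring
  have : 0 ≤ (v - u) ^ 2 * (v * (v + 2 * u)) / (2 * u ^ 3) := by positivity
  linarith

/-- The square root has infinite slope at `0`: moving mass `u²` to an empty arm changes the other
terms by `O(u²)` but gains `2 r u` from the entropy. -/
lemma pos_of_isMinOn_tsallis {K : ℕ} {c q : Fin K → ℝ} {r : ℝ} (hr : 0 < r)
    (hq : q ∈ stdSimplex ℝ (Fin K))
    (hmin : IsMinOn (fun p => ∑ a, c a * p a + r * tsallis (1 / 2) p) (stdSimplex ℝ (Fin K)) q)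
    (a : Fin K) : 0 < q a := by
  refine lt_of_le_of_ne (hq.1 a) fun h0 => ?_
  -- `M` collects the terms of order `u²`, so minimality forces `2 r u ≤ u² M`; the choice of `u`
  -- gives `u M ≤ r`, a contradiction.
  set M : ℝ := c a - ∑ b, c b * q b + 2 * r * ∑ b, √(q b) with hM
  set u : ℝ := r / (r + |M|) with hu
  have hden : 0 < r + |M| := by positivity
  have hu0 : 0 < u := by positivity
  have hu1 : u ≤ 1 := by
    rw [hu, div_le_one hden]
    linarith [abs_nonneg M]
  have hus : u ^ 2 ≤ 1 := by nlinarith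
  set p : Fin K → ℝ := fun b => (1 - u ^ 2) * q b + u ^ 2 * (if b = a then 1 else 0) with hp
  have hps : p ∈ stdSimplex ℝ (Fin K) := by
    refine ⟨fun b => ?_, ?_⟩
    · have := hq.1 b
      have h2 : (0 : ℝ) ≤ if b = a then 1 else 0 := by split_ifs <;> norm_num
      have h3 : 0 ≤ 1 - u ^ 2 := by linarith
      positivity
    · simp only [hp, Finset.sum_add_distrib, ← Finset.mul_sum, hq.2]
      simp
  have hlin : ∑ b, c b * p b = (1 - u ^ 2) * ∑ b, c b * q b + u ^ 2 * c a := by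
    simp only [hp, mul_add, Finset.sum_add_distrib, Finset.mul_sum]
    congr 1
    · exact Finset.sum_congr rfl fun b _ => by ring
    · simp [mul_comm]
  have hroot : (1 - u ^ 2) * ∑ b, √(q b) + u ≤ ∑ b, √(p b) := by
    have h1 : ∀ b, (1 - u ^ 2) * √(q b) + (if b = a then u else 0) ≤ √(p b) := by
      intro b
      have h3 : 0 ≤ 1 - u ^ 2 := by linarith
      split_ifs with hb
      · subst hb
        simp [hp, ← h0, Real.sqrt_sq hu0.le]
      · apply Real.le_sqrt_of_sq_le
        simp only [hp, hb, if_false, add_zero, mul_zero]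
        rw [mul_pow, Real.sq_sqrt (hq.1 b)]
        have := hq.1 b
        have : (1 - u ^ 2) ^ 2 ≤ 1 - u ^ 2 := by nlinarith [sq_nonneg u]
        gcongr
    calc _ = ∑ b, ((1 - u ^ 2) * √(q b) + (if b = a then u else 0)) := by
          simp [Finset.sum_add_distrib, Finset.mul_sum]
      _ ≤ _ := Finset.sum_le_sum fun b _ => h1 b
  have := hmin hps
  simp only [Set.mem_ofPred_eq, tsallis_half, hlin] at this
  have h4 : 0 ≤ u ^ 2 * M - 2 * r * u := by
    rw [hM]
    nlinarith
  have h5 : u * M < 2 * r := by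
    have : u * M ≤ u * (r + |M|) := by
      gcongr
      linarith [le_abs_self M]
    have h6 : u * (r + |M|) = r := by rw [hu]; field_simp
    linarith
  nlinarith

/-- The sum on the left is the Bregman divergence of `ψ`, so the claim is the first-order condition
at `q`, namely `0 ≤ D` for the directional derivative `D` towards `p`. All arms have positive mass,
so `D` makes sense. -/
lemma bregman_le_of_isMinOn_tsallis {K : ℕ} {c q p : Fin K → ℝ} {r : ℝ} (hr : 0 < r)
    (hq : q ∈ stdSimplex ℝ (Fin K)) (hp : p ∈ stdSimplex ℝ (Fin K))
    (hmin : IsMinOn (fun p => ∑ a, c a * p a + r * tsallis (1 / 2) p) (stdSimplex ℝ (Fin K)) q) :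
    r * ∑ a, (√(p a) - √(q a)) ^ 2 / √(q a) ≤
      (∑ a, c a * p a + r * tsallis (1 / 2) p) - (∑ a, c a * q a + r * tsallis (1 / 2) q) := by
  have hpos := pos_of_isMinOn_tsallis hr hq hmin
  set D : ℝ := ∑ a, c a * (p a - q a) - r * ∑ a, (p a - q a) / √(q a) with hD
  set N : ℝ := r * ∑ a, (p a - q a) ^ 2 / (q a * √(q a)) with hN
  have hN0 : 0 ≤ N := by
    rw [hN]
    refine mul_nonneg hr.le (Finset.sum_nonneg fun a _ => ?_)
    have := hpos a
    positivity
  have hstep : ∀ s : ℝ, 0 < s → s ≤ 1 → 0 ≤ D + s * N := by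
    intro s hs0 hs1
    have hmem : (fun a => q a + s * (p a - q a)) ∈ stdSimplex ℝ (Fin K) := by
      refine ⟨fun a => ?_, ?_⟩
      · have h1 := hq.1 a
        have h2 := hp.1 a
        show 0 ≤ q a + s * (p a - q a)
        nlinarith
      · simp [Finset.sum_add_distrib, ← Finset.mul_sum, hq.2, hp.2]
    have h1 := hmin hmem
    simp only [Set.mem_ofPred_eq, tsallis_half] at h1
    have h2 : ∑ a, (√(q a) + s * ((p a - q a) / √(q a)) / 2 -
        s ^ 2 * ((p a - q a) ^ 2 / (q a * √(q a))) / 2) ≤ ∑ a, √(q a + s * (p a - q a)) := by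
      refine Finset.sum_le_sum fun a _ => ?_
      have h3 := sqrt_lower_bound (hpos a) (hmem.1 a)
      simp only [add_sub_cancel_left] at h3
      refine le_trans (le_of_eq ?_) h3
      have := Real.sqrt_pos.2 (hpos a)
      have := hpos a
      field_simp
    simp only [Finset.sum_add_distrib, Finset.sum_sub_distrib, ← Finset.mul_sum, ← Finset.sum_div] at h2
    have h4 : ∑ a, c a * (q a + s * (p a - q a)) = ∑ a, c a * q a + s * ∑ a, c a * (p a - q a) := by
      rw [Finset.mul_sum, ← Finset.sum_add_distrib]
      exact Finset.sum_congr rfl fun a _ => by ring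
    rw [h4] at h1
    have h5 : 0 ≤ s * (D + s * N) := by
      rw [hD, hN]
      have := mul_le_mul_of_nonneg_left h2 hr.le
      nlinarith
    exact nonneg_of_mul_nonneg_right h5 hs0
  have hD0 : 0 ≤ D := by
    by_contra! hneg
    -- This `s` lies in `(0, 1]` even if `N = 0`, and turns `D + s N` into `-D² / (N - D) < 0`.
    have h1 := hstep (-D / (N - D)) (by apply div_pos <;> linarith)
      (by rw [div_le_one (by linarith)]; linarith)
    have h2 : D + -D / (N - D) * N = -(D ^ 2 / (N - D)) := by
      have : N - D ≠ 0 := by linarith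
      field_simp
      ring
    have h3 : 0 < D ^ 2 / (N - D) := by
      have : 0 < N - D := by linarith
      have : D ≠ 0 := hneg.ne
      positivity
    linarith
  have hsum : ∑ a, (√(p a) - √(q a)) ^ 2 / √(q a) =
      ∑ a, (p a - q a) / √(q a) - 2 * (∑ a, √(p a) - ∑ a, √(q a)) := by
    rw [← Finset.sum_sub_distrib, Finset.mul_sum, ← Finset.sum_sub_distrib]
    refine Finset.sum_congr rfl fun a _ => ?_
    have h1 := Real.sqrt_pos.2 (hpos a)
    have h2 := Real.sq_sqrt (hpos a).le
    have h3 := Real.sq_sqrt (hp.1 a)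
    field_simp
    linarith
  have hlin : ∑ a, c a * (p a - q a) = ∑ a, c a * p a - ∑ a, c a * q a := by
    rw [← Finset.sum_sub_distrib]
    exact Finset.sum_congr rfl fun a _ => by ring
  rw [hsum, tsallis_half, tsallis_half]
  rw [hD, hlin] at hD0
  linarith

/-- Half of the Bregman term completes the square with the linear term; the other half stays
nonnegative after the loss term is added, because `√x |l| ≤ r / 2`. No closeness of `x` and `y` is
needed. -/
lemma mul_sub_bregman_le {r l x y : ℝ} (hr : 0 < r) (hx : 0 < x) (hy : 0 ≤ y)
    (hl : √x * |l| ≤ r / 2) :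
    l * (x - y) - r * ((√y - √x) ^ 2 / √x) ≤ 2 / r * (x * √x * l ^ 2) := by
  obtain ⟨u, hu, rfl⟩ : ∃ u, 0 < u ∧ x = u ^ 2 := ⟨√x, Real.sqrt_pos.2 hx, (Real.sq_sqrt hx.le).symm⟩
  obtain ⟨v, hv, rfl⟩ : ∃ v, 0 ≤ v ∧ y = v ^ 2 := ⟨√y, Real.sqrt_nonneg _, (Real.sq_sqrt hy).symm⟩
  rw [Real.sqrt_sq hu.le] at *
  rw [Real.sqrt_sq hv]
  have h1 : -(u * l) ≤ r / 2 := by nlinarith [neg_abs_le l]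
  have h2 : 2 / r * (u ^ 2 * u * l ^ 2) - (l * (u ^ 2 - v ^ 2) - r * ((v - u) ^ 2 / u))
      = ((v - u) ^ 2 * (r / 2 - -(u * l)) + (r * (v - u) + 2 * u ^ 2 * l) ^ 2 / (2 * r)) / u := by
    field_simp
    ring
  have h3 : 0 ≤ ((v - u) ^ 2 * (r / 2 - -(u * l)) + (r * (v - u) + 2 * u ^ 2 * l) ^ 2 / (2 * r)) / u := by
    have : 0 ≤ r / 2 - -(u * l) := by linarith
    positivity
  linarith

/-- The stability of one step of FTRL with the `1/2`-Tsallis entropy, relative to an arm `b`. -/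
lemma stability_tsallis {K : ℕ} {c q p l : Fin K → ℝ} {r : ℝ} (hr : 0 < r)
    (hq : q ∈ stdSimplex ℝ (Fin K)) (hp : p ∈ stdSimplex ℝ (Fin K))
    (hmin : IsMinOn (fun p => ∑ a, c a * p a + r * tsallis (1 / 2) p) (stdSimplex ℝ (Fin K)) q)
    (hl : ∀ a, √(q a) * |l a| ≤ r / 4) (b : Fin K) :
    (∑ a, c a * q a + r * tsallis (1 / 2) q) + ∑ a, l a * q a -
      (∑ a, c a * p a + r * tsallis (1 / 2) p) - ∑ a, l a * p a ≤
      4 / r * (√(1 - q b) * ∑ a, q a * l a ^ 2) := by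
  have hpos := pos_of_isMinOn_tsallis hr hq hmin
  have hbreg := bregman_le_of_isMinOn_tsallis hr hq hp hmin
  have hle1 : ∀ a, q a ≤ 1 := fun a => hq.2 ▸ Finset.single_le_sum (fun i _ => hq.1 i) (Finset.mem_univ a)
  -- Both `p` and `q` sum to `1`, so subtracting a common constant `s` from the losses changes
  -- nothing on the left.
  have hshift : ∀ s : ℝ, (∀ a, √(q a) * |l a - s| ≤ r / 2) →
      (∑ a, c a * q a + r * tsallis (1 / 2) q) + ∑ a, l a * q a -
      (∑ a, c a * p a + r * tsallis (1 / 2) p) - ∑ a, l a * p a ≤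
      2 / r * ∑ a, q a * √(q a) * (l a - s) ^ 2 := by
    intro s hs
    have h1 : ∑ a, ((l a - s) * (q a - p a) - r * ((√(p a) - √(q a)) ^ 2 / √(q a))) ≤
        ∑ a, 2 / r * (q a * √(q a) * (l a - s) ^ 2) :=
      Finset.sum_le_sum fun a _ => mul_sub_bregman_le hr (hpos a) (hp.1 a) (hs a)
    have h2 : ∑ a, (l a - s) * (q a - p a) = ∑ a, l a * q a - ∑ a, l a * p a := by
      have : ∑ a, (l a - s) * (q a - p a) =
          ∑ a, l a * q a - ∑ a, l a * p a - s * (∑ a, q a - ∑ a, p a) := by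
        rw [← Finset.sum_sub_distrib, ← Finset.sum_sub_distrib, Finset.mul_sum,
          ← Finset.sum_sub_distrib]
        exact Finset.sum_congr rfl fun a _ => by ring
      rw [this, hq.2, hp.2]
      ring
    rw [Finset.sum_sub_distrib, h2, ← Finset.mul_sum, ← Finset.mul_sum] at h1
    linarith
  have hqsum : ∀ a, a ≠ b → q a ≤ 1 - q b := by
    intro a hab
    have : q a + q b ≤ ∑ i, q i := by
      rw [← Finset.sum_pair hab]
      exact Finset.sum_le_sum_of_subset_of_nonneg (Finset.subset_univ _) fun i _ _ => hq.1 i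
    rw [hq.2] at this
    linarith
  have hw : 0 ≤ 1 - q b := by linarith [hle1 b]
  -- If `q b ≥ 1/2`, shifting by `l b` removes arm `b` from the variance, and every other arm has
  -- `√(q a) ≤ √(1 - q b)`. Otherwise `√(1 - q b) ≥ 1/2` and the factor is free.
  rcases le_total (1 / 2) (q b) with hb | hb
  · have h1 := hshift (l b) fun a => by
      by_cases hab : a = b
      · subst hab
        simp
        positivity
      · calc √(q a) * |l a - l b| ≤ √(q a) * (|l a| + |l b|) := by
              gcongr
              exact abs_sub _ _
          _ ≤ √(q a) * |l a| + √(q b) * |l b| := by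
              rw [mul_add]
              gcongr
              linarith [hqsum a hab]
          _ ≤ r / 2 := by linarith [hl a, hl b]
    refine h1.trans ?_
    have h2 : ∑ a, q a * √(q a) * (l a - l b) ^ 2 ≤ 2 * (√(1 - q b) * ∑ a, q a * l a ^ 2) := by
      have h3 : ∀ a, q a * √(q a) * (l a - l b) ^ 2 ≤
          2 * √(1 - q b) * (if a = b then 0 else q a * l a ^ 2 + q a * l b ^ 2) := by
        intro a
        split_ifs with hab
        · simp [hab]
        · have h4 : √(q a) ≤ √(1 - q b) := Real.sqrt_le_sqrt (hqsum a hab)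
          have h5 : (l a - l b) ^ 2 ≤ 2 * (l a ^ 2 + l b ^ 2) := by nlinarith [sq_nonneg (l a + l b)]
          have := (hpos a).le
          calc q a * √(q a) * (l a - l b) ^ 2 ≤ q a * √(1 - q b) * (2 * (l a ^ 2 + l b ^ 2)) := by
                gcongr
            _ = _ := by ring
      -- The shift contributes `(1 - q b) (l b)²`, which the missing term `q b (l b)²` pays for
      -- since `q b ≥ 1/2`.
      have h6 : ∑ a, (if a = b then 0 else q a * l a ^ 2 + q a * l b ^ 2) ≤ ∑ a, q a * l a ^ 2 := by
        have h7 : ∀ f : Fin K → ℝ, ∑ a, (if a = b then 0 else f a) = ∑ a, f a - f b := by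
          intro f
          rw [eq_sub_iff_add_eq]
          have : f b = ∑ a, if a = b then f a else 0 := by simp
          refine (congrArg _ this).trans ?_
          rw [← Finset.sum_add_distrib]
          exact Finset.sum_congr rfl fun a _ => by split_ifs <;> simp
        rw [h7, Finset.sum_add_distrib, ← Finset.sum_mul, hq.2]
        nlinarith [sq_nonneg (l b)]
      calc _ ≤ _ := Finset.sum_le_sum fun a _ => h3 a
        _ = 2 * √(1 - q b) * ∑ a, (if a = b then 0 else q a * l a ^ 2 + q a * l b ^ 2) := by
          rw [Finset.mul_sum]
        _ ≤ 2 * √(1 - q b) * ∑ a, q a * l a ^ 2 := by gcongr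
        _ = _ := by ring
    calc _ ≤ 2 / r * (2 * (√(1 - q b) * ∑ a, q a * l a ^ 2)) := by gcongr
      _ = _ := by ring
  · have h1 := hshift 0 fun a => by
      rw [sub_zero]
      linarith [hl a]
    refine h1.trans ?_
    have h2 : 1 ≤ 2 * √(1 - q b) := by
      have : 1 / 2 ≤ √(1 - q b) := Real.le_sqrt_of_sq_le (by norm_num; linarith)
      linarith
    have h3 : ∑ a, q a * √(q a) * (l a - 0) ^ 2 ≤ ∑ a, q a * l a ^ 2 := by
      refine Finset.sum_le_sum fun a _ => ?_
      have h4 : √(q a) ≤ 1 := Real.sqrt_le_one.2 (hle1 a)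
      have := (hpos a).le
      rw [sub_zero]
      calc q a * √(q a) * l a ^ 2 ≤ q a * 1 * l a ^ 2 := by gcongr
        _ = _ := by ring
    have h5 : 0 ≤ ∑ a, q a * l a ^ 2 := Finset.sum_nonneg fun a _ => mul_nonneg (hq.1 a) (sq_nonneg _)
    calc _ ≤ 2 / r * ((2 * √(1 - q b)) * ∑ a, q a * l a ^ 2) := by
          gcongr
          nlinarith
      _ = _ := by ring

/-- The FTRL objective of a deterministic loss sequence. -/
noncomputable def ftrlValue {K : ℕ} (l : ℕ → Fin K → ℝ) (r : ℕ → ℝ) (t : ℕ) (p : Fin K → ℝ) : ℝ :=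
  ∑ s ∈ Finset.Icc 1 (t - 1), ∑ a, l s a * p a + r (t - 1) * tsallis (1 / 2) p

lemma ftrlValue_eq {K : ℕ} (l : ℕ → Fin K → ℝ) (r : ℕ → ℝ) (t : ℕ) (p : Fin K → ℝ) :
    ftrlValue l r t p =
      ∑ a, (∑ s ∈ Finset.Icc 1 (t - 1), l s a) * p a + r (t - 1) * tsallis (1 / 2) p := by
  rw [ftrlValue, Finset.sum_comm]
  simp only [Finset.sum_mul]

/-- Telescoping: passing from the objective of round `t` to that of round `t + 1` adds the loss of
round `t` and `(r t - r (t - 1)) ψ`, both evaluated at `q (t + 1)`. -/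
lemma sum_loss_eq_ftrlValue {K : ℕ} (l : ℕ → Fin K → ℝ) (r : ℕ → ℝ) (hr : r 0 = 0)
    (q : ℕ → Fin K → ℝ) (n : ℕ) :
    ∑ t ∈ Finset.Icc 1 n, ∑ a, l t a * q t a = ftrlValue l r (n + 1) (q (n + 1)) +
      ∑ t ∈ Finset.Icc 1 n, ((ftrlValue l r t (q t) + ∑ a, l t a * q t a -
        ftrlValue l r t (q (t + 1)) - ∑ a, l t a * q (t + 1) a) -
        (r t - r (t - 1)) * tsallis (1 / 2) (q (t + 1))) := by
  induction n with
  | zero => simp [ftrlValue, hr]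
  | succ n ih =>
    rw [Finset.sum_Icc_succ_top (by omega), Finset.sum_Icc_succ_top (by omega), ih]
    simp only [ftrlValue, Nat.add_sub_cancel]
    rw [Finset.sum_Icc_succ_top (by omega)]
    ring

/-- In `∑ √p - 1`, arm `b` contributes at most `1`, which cancels; Cauchy–Schwarz handles the other
arms, whose total mass is `1 - p b`. -/
lemma neg_tsallis_le {K : ℕ} {p : Fin K → ℝ} (hp : p ∈ stdSimplex ℝ (Fin K)) (b : Fin K) :
    -tsallis (1 / 2) p ≤ 2 * (√K * √(1 - p b)) := by
  rw [tsallis_half]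
  have hle1 : ∀ a, p a ≤ 1 := fun a => hp.2 ▸ Finset.single_le_sum (fun i _ => hp.1 i) (Finset.mem_univ a)
  have h1 : ∑ a ∈ Finset.univ.erase b, √(p a) ≤ √K * √(1 - p b) := by
    rw [← Real.sqrt_mul (Nat.cast_nonneg K)]
    apply Real.le_sqrt_of_sq_le
    calc (∑ a ∈ Finset.univ.erase b, √(p a)) ^ 2
        ≤ (Finset.univ.erase b).card * ∑ a ∈ Finset.univ.erase b, √(p a) ^ 2 :=
          sq_sum_le_card_mul_sum_sq
      _ = (Finset.univ.erase b).card * (1 - p b) := by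
          congr 1
          rw [← hp.2, ← Finset.add_sum_erase _ _ (Finset.mem_univ b), add_sub_cancel_left]
          exact Finset.sum_congr rfl fun a _ => Real.sq_sqrt (hp.1 a)
      _ ≤ K * (1 - p b) := by
          have : 0 ≤ 1 - p b := by linarith [hle1 b]
          gcongr
          exact (Finset.card_le_univ _).trans (by simp)
  have h2 : √(p b) ≤ 1 := Real.sqrt_le_one.2 (hle1 b)
  rw [← Finset.add_sum_erase _ _ (Finset.mem_univ b)]
  linarith

/-- A bound on the loss of FTRL against a vertex of the simplex. -/
lemma ftrl_bound {K : ℕ} (l : ℕ → Fin K → ℝ) (r : ℕ → ℝ) (hr0 : r 0 = 0)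
    (hrpos : ∀ t, 1 ≤ t → 0 < r t) (hmono : ∀ t, 1 ≤ t → r (t - 1) ≤ r t)
    (q : ℕ → Fin K → ℝ) (n : ℕ) (hn : 1 ≤ n)
    (hq : ∀ t ∈ Finset.Icc 1 (n + 1), q t ∈ stdSimplex ℝ (Fin K))
    (hmin : ∀ t ∈ Finset.Icc 1 (n + 1), IsMinOn (ftrlValue l r t) (stdSimplex ℝ (Fin K)) (q t))
    (hl : ∀ t ∈ Finset.Icc 2 n, ∀ a, √(q t a) * |l t a| ≤ r (t - 1) / 4) (b : Fin K) :
    ∑ t ∈ Finset.Icc 1 n, (∑ a, l t a * q t a - l t b) ≤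
      ∑ a, l 1 a * (q 1 a - q 2 a) +
      ∑ t ∈ Finset.Icc 2 n, 4 / r (t - 1) * (√(1 - q t b) * ∑ a, q t a * l t a ^ 2) +
      ∑ t ∈ Finset.Icc 1 n, (r t - r (t - 1)) * (2 * (√K * √(1 - q (t + 1) b))) := by
  -- The entropy vanishes at a vertex of the simplex, so comparing with arm `b` leaves no
  -- regularization term.
  have hvert : ftrlValue l r (n + 1) (q (n + 1)) ≤ ∑ t ∈ Finset.Icc 1 n, l t b := by
    have h1 : Pi.single b (1 : ℝ) ∈ stdSimplex ℝ (Fin K) := by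
      simpa using single_mem_stdSimplex ℝ b
    have h2 := hmin (n + 1) (by simp) h1
    refine (Set.mem_ofPred_eq ▸ h2 : _ ≤ _).trans (le_of_eq ?_)
    have h3 : tsallis (1 / 2) (Pi.single b (1 : ℝ)) = 0 := by
      rw [tsallis_half, Finset.sum_eq_single b] <;> simp +contextual
    rw [ftrlValue, h3]
    simp [Pi.single_apply]
  rw [Finset.sum_sub_distrib, sum_loss_eq_ftrlValue l r hr0 q n]
  have hstab : ∑ t ∈ Finset.Icc 1 n, (ftrlValue l r t (q t) + ∑ a, l t a * q t a -
        ftrlValue l r t (q (t + 1)) - ∑ a, l t a * q (t + 1) a) ≤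
      ∑ a, l 1 a * (q 1 a - q 2 a) +
      ∑ t ∈ Finset.Icc 2 n, 4 / r (t - 1) * (√(1 - q t b) * ∑ a, q t a * l t a ^ 2) := by
    -- Round `1` is split off: since `r 0 = 0` its objective is zero and the stability estimate,
    -- which needs `r > 0`, does not apply.
    rw [← Finset.add_sum_Ioc_eq_sum_Icc hn]
    have hIoc : Finset.Ioc 1 n = Finset.Icc 2 n := by
      ext t
      simp only [Finset.mem_Ioc, Finset.mem_Icc]
      omega
    rw [hIoc]
    refine add_le_add (le_of_eq ?_) (Finset.sum_le_sum fun t ht => ?_)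
    · simp [ftrlValue, hr0, mul_sub]
    · have ht' := Finset.mem_Icc.1 ht
      have h1 : 1 ≤ t - 1 := by omega
      have hm := hmin t (Finset.mem_Icc.2 (by omega))
      have hfun : ftrlValue l r t = fun p =>
          ∑ a, (∑ s ∈ Finset.Icc 1 (t - 1), l s a) * p a + r (t - 1) * tsallis (1 / 2) p :=
        funext fun p => ftrlValue_eq l r t p
      rw [hfun] at hm ⊢
      exact stability_tsallis (hrpos _ h1) (hq t (Finset.mem_Icc.2 (by omega)))
        (hq (t + 1) (Finset.mem_Icc.2 (by omega))) hm (hl t ht) b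
  have hpen : ∑ t ∈ Finset.Icc 1 n, (r t - r (t - 1)) * -tsallis (1 / 2) (q (t + 1)) ≤
      ∑ t ∈ Finset.Icc 1 n, (r t - r (t - 1)) * (2 * (√K * √(1 - q (t + 1) b))) := by
    refine Finset.sum_le_sum fun t ht => ?_
    have ht' := Finset.mem_Icc.1 ht
    exact mul_le_mul_of_nonneg_left
      (neg_tsallis_le (hq (t + 1) (Finset.mem_Icc.2 (by omega))) b) (sub_nonneg.2 (hmono t ht'.1))
  rw [Finset.sum_sub_distrib]
  simp only [mul_neg, Finset.sum_neg_distrib] at hpen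
  linarith

/-! ### Covariance matrices -/

section Cov

variable {𝒳 : Type*} [MeasurableSpace 𝒳] [Fintype 𝒳] {d K : ℕ} (P : Problem 𝒳 d K)

lemma Problem.dotProduct_cov_mulVec (p : 𝒳 → Fin K → ℝ) (u v : Fin d → ℝ) :
    u ⬝ᵥ (P.cov p *ᵥ v) = ∑ x, P.g x * ∑ a, p x a * ((P.φ a x ⬝ᵥ u) * (P.φ a x ⬝ᵥ v)) := by
  simp only [Problem.cov, Matrix.sum_mulVec, Matrix.smul_mulVec, dotProduct_sum,
    dotProduct_smul, smul_eq_mul, Matrix.vecMulVec_mulVec]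
  refine Finset.sum_congr rfl fun x _ => ?_
  congr 1
  refine Finset.sum_congr rfl fun a _ => ?_
  simp [dotProduct_comm u]

omit [Fintype 𝒳] in
lemma Problem.g_nonneg (x : 𝒳) : 0 ≤ P.g x := measureReal_nonneg

lemma Problem.sum_g [MeasurableSingletonClass 𝒳] : ∑ x, P.g x = 1 := by
  have := P.isProbabilityMeasure_G
  simp [Problem.g]

lemma Problem.cov_mulVec_comm (p : 𝒳 → Fin K → ℝ) (u v : Fin d → ℝ) :
    u ⬝ᵥ (P.cov p *ᵥ v) = v ⬝ᵥ (P.cov p *ᵥ u) := by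
  simp only [P.dotProduct_cov_mulVec, mul_comm (P.φ _ _ ⬝ᵥ u)]

lemma Problem.cov_nonneg {p : 𝒳 → Fin K → ℝ} (hp : ∀ x a, 0 ≤ p x a) (u : Fin d → ℝ) :
    0 ≤ u ⬝ᵥ (P.cov p *ᵥ u) := by
  rw [P.dotProduct_cov_mulVec]
  exact Finset.sum_nonneg fun x _ => mul_nonneg (P.g_nonneg x)
    (Finset.sum_nonneg fun a _ => mul_nonneg (hp x a) (mul_self_nonneg _))

lemma Problem.cov_cauchy_schwarz {p : 𝒳 → Fin K → ℝ} (hp : ∀ x a, 0 ≤ p x a) (u v : Fin d → ℝ) :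
    (u ⬝ᵥ (P.cov p *ᵥ v)) ^ 2 ≤ (u ⬝ᵥ (P.cov p *ᵥ u)) * (v ⬝ᵥ (P.cov p *ᵥ v)) := by
  have h : ∀ s : ℝ, 0 ≤ (v ⬝ᵥ (P.cov p *ᵥ v)) * (s * s) + (2 * (u ⬝ᵥ (P.cov p *ᵥ v))) * s +
      u ⬝ᵥ (P.cov p *ᵥ u) := by
    intro s
    have h1 := P.cov_nonneg hp (u + s • v)
    simp only [Matrix.mulVec_add, Matrix.mulVec_smul, add_dotProduct, dotProduct_add,
      smul_dotProduct, dotProduct_smul, smul_eq_mul] at h1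
    rw [P.cov_mulVec_comm p v u] at h1
    linarith
  have := discrim_le_zero h
  rw [discrim] at this
  nlinarith

section Inverse

variable {P} {p : 𝒳 → Fin K → ℝ} (hu : IsUnit (P.cov p))
include hu

lemma Problem.cov_mulVec_inv (u : Fin d → ℝ) : P.cov p *ᵥ ((P.cov p)⁻¹ *ᵥ u) = u := by
  rw [Matrix.mulVec_mulVec, Matrix.mul_nonsing_inv _ ((Matrix.isUnit_iff_isUnit_det _).1 hu),
    Matrix.one_mulVec]

lemma Problem.dotProduct_inv_eq (u v : Fin d → ℝ) :
    u ⬝ᵥ ((P.cov p)⁻¹ *ᵥ v) =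
      ((P.cov p)⁻¹ *ᵥ u) ⬝ᵥ (P.cov p *ᵥ ((P.cov p)⁻¹ *ᵥ v)) := by
  rw [P.cov_mulVec_comm, Problem.cov_mulVec_inv hu, dotProduct_comm]

lemma Problem.inv_comm (u v : Fin d → ℝ) :
    u ⬝ᵥ ((P.cov p)⁻¹ *ᵥ v) = v ⬝ᵥ ((P.cov p)⁻¹ *ᵥ u) := by
  rw [Problem.dotProduct_inv_eq hu, P.cov_mulVec_comm, ← Problem.dotProduct_inv_eq hu]

/-- This is `Σ⁻¹ Σ = 1` read as an average over contexts and arms; with `v = θ₀` it makes the loss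
estimator unbiased. -/
lemma Problem.sum_inv_mul (u v : Fin d → ℝ) :
    ∑ x, P.g x * ∑ a, p x a * ((u ⬝ᵥ ((P.cov p)⁻¹ *ᵥ P.φ a x)) * (P.φ a x ⬝ᵥ v)) = u ⬝ᵥ v := by
  have h := P.dotProduct_cov_mulVec p ((P.cov p)⁻¹ *ᵥ u) v
  rw [P.cov_mulVec_comm, Problem.cov_mulVec_inv hu, dotProduct_comm v u] at h
  rw [h]
  simp only [Problem.inv_comm hu u]

lemma Problem.sum_inv_sq (u : Fin d → ℝ) :
    ∑ x, P.g x * ∑ a, p x a * (u ⬝ᵥ ((P.cov p)⁻¹ *ᵥ P.φ a x)) ^ 2 = u ⬝ᵥ ((P.cov p)⁻¹ *ᵥ u) := by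
  rw [← Problem.sum_inv_mul hu]
  simp only [← Problem.inv_comm hu u, sq]

/-- The left side is the trace of `Σ⁻¹ Σ`. This is where the dimension enters the variance. -/
lemma Problem.sum_inv_self :
    ∑ x, P.g x * ∑ a, p x a * (P.φ a x ⬝ᵥ ((P.cov p)⁻¹ *ᵥ P.φ a x)) = d := by
  have h : ((P.cov p)⁻¹ * P.cov p).trace = d := by
    rw [Matrix.nonsing_inv_mul _ ((Matrix.isUnit_iff_isUnit_det _).1 hu)]
    simp
  rw [← h]
  nth_rewrite 3 [Problem.cov]
  simp only [Matrix.mul_sum, Matrix.mul_smul, Matrix.trace_sum, Matrix.trace_smul,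
    Matrix.mul_vecMulVec, Matrix.trace_vecMulVec, smul_eq_mul]
  simp only [dotProduct_comm (P.φ _ _)]

variable (hp : ∀ x a, 0 ≤ p x a)
include hp

lemma Problem.inv_nonneg (u : Fin d → ℝ) : 0 ≤ u ⬝ᵥ ((P.cov p)⁻¹ *ᵥ u) := by
  rw [Problem.dotProduct_inv_eq hu]
  exact P.cov_nonneg hp _

lemma Problem.inv_cauchy_schwarz (u v : Fin d → ℝ) :
    (u ⬝ᵥ ((P.cov p)⁻¹ *ᵥ v)) ^ 2 ≤
      (u ⬝ᵥ ((P.cov p)⁻¹ *ᵥ u)) * (v ⬝ᵥ ((P.cov p)⁻¹ *ᵥ v)) := by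
  simp only [Problem.dotProduct_inv_eq hu]
  exact P.cov_cauchy_schwarz hp _ _

/-- With `s = φᵀ Σ⁻¹ φ`, the identity `sum_inv_sq` at `u = φ(a, x)` has total `s` and contains the
term `g p s²`. -/
lemma Problem.mul_inv_self_le_one (a : Fin K) (x : 𝒳) :
    P.g x * p x a * (P.φ a x ⬝ᵥ ((P.cov p)⁻¹ *ᵥ P.φ a x)) ≤ 1 := by
  set s := P.φ a x ⬝ᵥ ((P.cov p)⁻¹ *ᵥ P.φ a x) with hs
  have hs0 : 0 ≤ s := Problem.inv_nonneg hu hp _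
  have h1 := Problem.sum_inv_sq hu (P.φ a x)
  have h2 : P.g x * (p x a * s ^ 2) ≤ s := by
    rw [← hs] at h1
    refine le_trans ?_ h1.le
    calc P.g x * (p x a * s ^ 2)
        ≤ P.g x * ∑ b, p x b * (P.φ a x ⬝ᵥ ((P.cov p)⁻¹ *ᵥ P.φ b x)) ^ 2 := by
          refine mul_le_mul_of_nonneg_left ?_ (P.g_nonneg x)
          exact Finset.single_le_sum
            (f := fun b => p x b * (P.φ a x ⬝ᵥ ((P.cov p)⁻¹ *ᵥ P.φ b x)) ^ 2)
            (fun b _ => mul_nonneg (hp x b) (sq_nonneg _)) (Finset.mem_univ a)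
      _ ≤ _ := Finset.single_le_sum
            (f := fun y => P.g y * ∑ b, p y b * (P.φ a x ⬝ᵥ ((P.cov p)⁻¹ *ᵥ P.φ b y)) ^ 2)
            (fun y _ => mul_nonneg (P.g_nonneg y)
              (Finset.sum_nonneg fun b _ => mul_nonneg (hp y b) (sq_nonneg _))) (Finset.mem_univ x)
  rcases hs0.eq_or_lt with h0 | h0
  · rw [← h0]
    simp
  · by_contra! h3
    nlinarith

end Inverse

/-! ### Comparison with the covariance of the exploration policy -/

variable {P} {lam : ℝ} {e : 𝒳 → Fin K → ℝ} (he : P.IsExplorationPolicy lam e)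
include he

lemma Problem.IsExplorationPolicy.natCast_le [MeasurableSingletonClass 𝒳] :
    (d : ℝ) ≤ 1 / lam := by
  rw [← Problem.sum_inv_self he.isUnit_cov]
  calc _ ≤ ∑ x, P.g x * ∑ a, e x a * (1 / lam) := by
        refine Finset.sum_le_sum fun x _ => mul_le_mul_of_nonneg_left ?_ (P.g_nonneg x)
        exact Finset.sum_le_sum fun a _ => mul_le_mul_of_nonneg_left
          (he.le_inv_lam _ (P.φ_mem a x)) ((he.mem_simplex x).1 a)
    _ = 1 / lam := by
        simp only [← Finset.sum_mul, (he.mem_simplex _).2, one_mul, P.sum_g]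

variable {p : 𝒳 → Fin K → ℝ} {γ : ℝ} (hγ : 0 < γ) (hp : ∀ x a, γ * e x a ≤ p x a)
include hγ hp

omit he hγ in
lemma Problem.mul_cov_le (u : Fin d → ℝ) :
    γ * (u ⬝ᵥ (P.cov e *ᵥ u)) ≤ u ⬝ᵥ (P.cov p *ᵥ u) := by
  simp only [P.dotProduct_cov_mulVec, Finset.mul_sum]
  refine Finset.sum_le_sum fun x _ => Finset.sum_le_sum fun a _ => ?_
  have h1 := mul_le_mul_of_nonneg_right (hp x a)
    (mul_nonneg (P.g_nonneg x) (mul_self_nonneg (P.φ a x ⬝ᵥ u)))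
  linarith

/-- A kernel vector `u` of `Σ(p)` satisfies `uᵀ Σ(e) u = 0` because `γ Σ(e) ≤ Σ(p)`; Cauchy–Schwarz
against `Σ(e) u` then forces `Σ(e) u = 0`. -/
lemma Problem.IsExplorationPolicy.isUnit_cov_of_le : IsUnit (P.cov p) := by
  rw [← Matrix.mulVec_injective_iff_isUnit]
  have he0 : ∀ x a, 0 ≤ e x a := fun x a => (he.mem_simplex x).1 a
  have hinj := Matrix.mulVec_injective_iff_isUnit.2 he.isUnit_cov
  rw [← Matrix.coe_mulVecLin] at hinj ⊢
  rw [injective_iff_map_eq_zero] at hinj ⊢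
  intro u hu
  apply hinj u
  rw [Matrix.mulVecLin_apply] at hu ⊢
  have h1 := Problem.mul_cov_le (P := P) hp u
  rw [hu, dotProduct_zero] at h1
  have h2 : u ⬝ᵥ (P.cov e *ᵥ u) = 0 := by
    have := P.cov_nonneg he0 u
    nlinarith
  have h3 := P.cov_cauchy_schwarz he0 (P.cov e *ᵥ u) u
  rw [h2, mul_zero] at h3
  have h4 : (P.cov e *ᵥ u) ⬝ᵥ (P.cov e *ᵥ u) = 0 := by nlinarith
  exact dotProduct_self_eq_zero.1 h4

/-- Inversion reverses `γ Σ(e) ≤ Σ(p)`. With `w = Σ(p)⁻¹ z` and `s = zᵀ w = wᵀ Σ(p) w`,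
Cauchy–Schwarz for `Σ(e)` gives `s² ≤ (zᵀ Σ(e)⁻¹ z) (wᵀ Σ(e) w)`, hence `γ lam s² ≤ s`. -/
lemma Problem.IsExplorationPolicy.inv_self_le {z : Fin d → ℝ} (hz : z ∈ P.Z) :
    z ⬝ᵥ ((P.cov p)⁻¹ *ᵥ z) ≤ 1 / (γ * lam) := by
  have he0 : ∀ x a, 0 ≤ e x a := fun x a => (he.mem_simplex x).1 a
  have hp0 : ∀ x a, 0 ≤ p x a := fun x a => (mul_nonneg hγ.le (he0 x a)).trans (hp x a)
  have hu := he.isUnit_cov_of_le hγ hp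
  have hl := he.lam_pos
  set w := (P.cov p)⁻¹ *ᵥ z with hw
  set s := z ⬝ᵥ w with hs
  have hs0 : 0 ≤ s := Problem.inv_nonneg hu hp0 z
  have h1 : s = w ⬝ᵥ (P.cov p *ᵥ w) := Problem.dotProduct_inv_eq hu z z
  have h2 := Problem.mul_cov_le (P := P) hp w
  have h3 := P.cov_cauchy_schwarz he0 ((P.cov e)⁻¹ *ᵥ z) w
  rw [← Problem.dotProduct_inv_eq he.isUnit_cov, P.cov_mulVec_comm,
    Problem.cov_mulVec_inv he.isUnit_cov, dotProduct_comm w z, ← hs] at h3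
  have h4 := he.le_inv_lam z hz
  have h5 : 0 ≤ w ⬝ᵥ (P.cov e *ᵥ w) := P.cov_nonneg he0 w
  have h6 : s ^ 2 ≤ 1 / lam * (w ⬝ᵥ (P.cov e *ᵥ w)) := h3.trans (by gcongr)
  have h7 : γ * lam * s ^ 2 ≤ s := by
    calc γ * lam * s ^ 2 ≤ γ * lam * (1 / lam * (w ⬝ᵥ (P.cov e *ᵥ w))) := by gcongr
      _ = γ * (w ⬝ᵥ (P.cov e *ᵥ w)) := by field_simp
      _ ≤ s := by rw [h1]; exact h2
  rw [le_div_iff₀ (by positivity)]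
  rcases hs0.eq_or_lt with h0 | h0
  · rw [← h0]
    simp
  · by_contra! h8
    nlinarith

end Cov

/-! ### Bounded measurable functions -/

/-- `f` is measurable with respect to `m` and almost surely bounded. -/
def AEBdd {Ω : Type*} (m : MeasurableSpace Ω) {mΩ : MeasurableSpace Ω} (μ : Measure Ω) (f : Ω → ℝ) :
    Prop :=
  Measurable[m] f ∧ ∃ C, ∀ᵐ ω ∂μ, |f ω| ≤ C

namespace AEBdd

variable {Ω ι : Type*} {m m' mΩ : MeasurableSpace Ω} {μ : Measure Ω} {f g : Ω → ℝ}

lemma const (c : ℝ) : AEBdd m μ fun _ => c :=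
  ⟨measurable_const, |c|, Filter.Eventually.of_forall fun _ => le_rfl⟩

lemma add (hf : AEBdd m μ f) (hg : AEBdd m μ g) : AEBdd m μ fun ω => f ω + g ω := by
  obtain ⟨hf, C, hC⟩ := hf
  obtain ⟨hg, D, hD⟩ := hg
  refine ⟨hf.add hg, C + D, ?_⟩
  filter_upwards [hC, hD] with ω h1 h2
  exact (abs_add_le _ _).trans (add_le_add h1 h2)

lemma mul (hf : AEBdd m μ f) (hg : AEBdd m μ g) : AEBdd m μ fun ω => f ω * g ω := by
  obtain ⟨hf, C, hC⟩ := hf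
  obtain ⟨hg, D, hD⟩ := hg
  refine ⟨hf.mul hg, C * D, ?_⟩
  filter_upwards [hC, hD] with ω h1 h2
  rw [abs_mul]
  exact mul_le_mul h1 h2 (abs_nonneg _) ((abs_nonneg _).trans h1)

lemma const_mul (c : ℝ) (hf : AEBdd m μ f) : AEBdd m μ fun ω => c * f ω := (const c).mul hf

lemma sub (hf : AEBdd m μ f) (hg : AEBdd m μ g) : AEBdd m μ fun ω => f ω - g ω := by
  simpa [sub_eq_add_neg] using hf.add (hg.const_mul (-1))

lemma pow_two (hf : AEBdd m μ f) : AEBdd m μ fun ω => f ω ^ 2 := by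
  simpa [sq] using hf.mul hf

lemma sqrt (hf : AEBdd m μ f) : AEBdd m μ fun ω => √(f ω) := by
  obtain ⟨hf, C, hC⟩ := hf
  refine ⟨hf.sqrt, √C, ?_⟩
  filter_upwards [hC] with ω h1
  rw [abs_of_nonneg (Real.sqrt_nonneg _)]
  exact Real.sqrt_le_sqrt ((le_abs_self _).trans h1)

lemma sum {s : Finset ι} {F : ι → Ω → ℝ} (hF : ∀ i ∈ s, AEBdd m μ (F i)) :
    AEBdd m μ fun ω => ∑ i ∈ s, F i ω := by
  classical
  induction s using Finset.induction_on with
  | empty => simpa using const 0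
  | insert i s hi ih =>
    simp only [Finset.sum_insert hi]
    exact (hF i (by simp)).add (ih fun j hj => hF j (by simp [hj]))

lemma mono (h : m ≤ m') (hf : AEBdd m μ f) : AEBdd m' μ f := ⟨hf.1.mono h le_rfl, hf.2⟩

lemma integrable [IsFiniteMeasure μ] (hf : AEBdd mΩ μ f) : Integrable f μ := by
  obtain ⟨hf, C, hC⟩ := hf
  exact Integrable.of_bound hf.aestronglyMeasurable C (by simpa using hC)

lemma of_forall (hf : Measurable[m] f) {C : ℝ} (h : ∀ ω, |f ω| ≤ C) : AEBdd m μ f :=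
  ⟨hf, C, Filter.Eventually.of_forall h⟩

end AEBdd

/-! ### One round of the protocol -/

section Round

variable {𝒳 Ω : Type*} [MeasurableSpace 𝒳] {m : MeasurableSpace Ω} [mΩ : MeasurableSpace Ω] {K : ℕ}
  {μ : Measure Ω} [IsProbabilityMeasure μ]

lemma integral_indicator_mul_of_condExp (hm : m ≤ mΩ) {f p H : Ω → ℝ}
    (hf : AEBdd mΩ μ f) (hp : μ[f | m] =ᵐ[μ] p) (hH : AEBdd m μ H) :
    ∫ ω, f ω * H ω ∂μ = ∫ ω, p ω * H ω ∂μ := by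
  rw [← integral_condExp hm]
  have h1 : μ[f * H | m] =ᵐ[μ] μ[f | m] * H :=
    condExp_mul_of_stronglyMeasurable_right hH.1.stronglyMeasurable
      (hf.mul (hH.mono hm)).integrable hf.integrable
  refine integral_congr_ae ?_
  filter_upwards [h1, hp] with ω h2 h3
  rw [← h3]
  exact h2

omit [IsProbabilityMeasure μ] in
lemma AEBdd.indicator_preimage {𝒴 : Type*} [MeasurableSpace 𝒴] [MeasurableSingletonClass 𝒴]
    {Y : Ω → 𝒴} (hY : Measurable[m] Y) (y : 𝒴) :
    AEBdd m μ ((Y ⁻¹' {y}).indicator fun _ => (1 : ℝ)) := by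
  refine .of_forall (C := 1) (measurable_const.indicator (hY (measurableSet_singleton y))) fun ω => ?_
  by_cases h : ω ∈ Y ⁻¹' {y} <;> simp [h]

variable [Fintype 𝒳] [MeasurableSingletonClass 𝒳]

omit [MeasurableSpace 𝒳] mΩ [MeasurableSingletonClass 𝒳] in
-- Arms and contexts are finite, so random indices can be frozen and conditioning applied to each
-- fixed pair.
lemma apply_eq_sum_indicator (A : Ω → Fin K) (X : Ω → 𝒳) (F : Fin K → 𝒳 → Ω → ℝ) (ω : Ω) :
    F (A ω) (X ω) ω = ∑ x, ∑ a, (A ⁻¹' {a}).indicator (fun _ => (1 : ℝ)) ω *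
      ((X ⁻¹' {x}).indicator (fun _ => (1 : ℝ)) ω * F a x ω) := by
  classical
  rw [Finset.sum_eq_single (X ω), Finset.sum_eq_single (A ω)]
  · simp
  · intro a _ ha
    simp [Set.indicator, ha.symm]
  · simp
  · intro x _ hx
    simp [Set.indicator, hx.symm]
  · simp

omit [IsProbabilityMeasure μ] in
lemma AEBdd.apply {A : Ω → Fin K} {X : Ω → 𝒳} (hA : Measurable A) (hX : Measurable X)
    {F : Fin K → 𝒳 → Ω → ℝ} (hF : ∀ a x, AEBdd mΩ μ (F a x)) :
    AEBdd mΩ μ fun ω => F (A ω) (X ω) ω := by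
  simp only [apply_eq_sum_indicator A X F]
  exact .sum fun x _ => .sum fun a _ =>
    (AEBdd.indicator_preimage hA a).mul ((AEBdd.indicator_preimage hX x).mul (hF a x))

variable {X : Ω → 𝒳} {A : Ω → Fin K} {ε : Fin K → Ω → ℝ}
  {π : Ω → 𝒳 → Fin K → ℝ}

omit [IsProbabilityMeasure μ] [Fintype 𝒳] in
lemma integral_indicator_mul_of_indep (hm : m ≤ mΩ) (hX : Measurable X)
    (hind : Indep (MeasurableSpace.comap X inferInstance) m μ)
    {H : Ω → ℝ} (hH : AEBdd m μ H) (x : 𝒳) :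
    ∫ ω, (X ⁻¹' {x}).indicator (fun _ => (1 : ℝ)) ω * H ω ∂μ =
      (μ.map X).real {x} * ∫ ω, H ω ∂μ := by
  have h1 : IndepFun ((X ⁻¹' {x}).indicator fun _ => (1 : ℝ)) H μ := by
    rw [IndepFun_iff_Indep]
    refine indep_of_indep_of_le_left (indep_of_indep_of_le_right hind hH.1.comap_le) ?_
    exact (AEBdd.indicator_preimage (μ := μ) (comap_measurable X) x).1.comap_le
  rw [h1.integral_fun_mul_eq_mul_integral
    (AEBdd.indicator_preimage (μ := μ) hX x).1.aestronglyMeasurable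
    (hH.mono hm).1.aestronglyMeasurable]
  congr 1
  rw [integral_indicator (hX (measurableSet_singleton x)),
    map_measureReal_apply hX (measurableSet_singleton x)]
  simp

variable (hm : m ≤ mΩ) (hX : Measurable X) (hA : Measurable A) (hε : ∀ a, AEBdd mΩ μ (ε a))
  (hind : Indep (MeasurableSpace.comap X inferInstance) m μ)
  (hnoise : ∀ a, μ[ε a | m ⊔ MeasurableSpace.comap X inferInstance] =ᵐ[μ] 0)
  (hπ : ∀ x a, AEBdd m μ fun ω => π ω x a)
  (hsamp : ∀ a, μ[(A ⁻¹' {a}).indicator (fun _ => (1 : ℝ)) |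
        m ⊔ MeasurableSpace.comap X inferInstance ⊔
          ⨆ b, MeasurableSpace.comap (ε b) inferInstance] =ᵐ[μ] fun ω => π ω (X ω) a)
include hm hX hA hε

include hsamp in
-- Conditioning includes the noise of the round, which the randomization of the arm ignores; so `F`
-- may depend on that noise.
lemma integral_apply_eq_sum_policy {F : Fin K → 𝒳 → Ω → ℝ}
    (hF : ∀ a x, AEBdd (m ⊔ MeasurableSpace.comap X inferInstance ⊔
          ⨆ b, MeasurableSpace.comap (ε b) inferInstance) μ (F a x)) :
    ∫ ω, F (A ω) (X ω) ω ∂μ =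
      ∑ x, ∑ a, ∫ ω, π ω x a * ((X ⁻¹' {x}).indicator (fun _ => (1 : ℝ)) ω * F a x ω) ∂μ := by
  have hM : m ⊔ MeasurableSpace.comap X inferInstance ⊔
      ⨆ b, MeasurableSpace.comap (ε b) inferInstance ≤ mΩ :=
    sup_le (sup_le hm hX.comap_le) (iSup_le fun b => (hε b).1.comap_le)
  have hXM : Measurable[m ⊔ MeasurableSpace.comap X inferInstance ⊔
      ⨆ b, MeasurableSpace.comap (ε b) inferInstance] X :=
    (comap_measurable X).mono (le_sup_right.trans le_sup_left) le_rfl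
  have hi : ∀ x a, AEBdd (m ⊔ MeasurableSpace.comap X inferInstance ⊔
          ⨆ b, MeasurableSpace.comap (ε b) inferInstance) μ
      fun ω => (X ⁻¹' {x}).indicator (fun _ => (1 : ℝ)) ω * F a x ω := fun x a =>
    (AEBdd.indicator_preimage hXM x).mul (hF a x)
  have hint : ∀ x a, Integrable (fun ω => (A ⁻¹' {a}).indicator (fun _ => (1 : ℝ)) ω *
      ((X ⁻¹' {x}).indicator (fun _ => (1 : ℝ)) ω * F a x ω)) μ := fun x a =>
    ((AEBdd.indicator_preimage hA a).mul ((hi x a).mono hM)).integrable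
  simp only [apply_eq_sum_indicator A X F]
  rw [integral_finsetSum _ fun x _ => integrable_finsetSum _ fun a _ => hint x a]
  refine Finset.sum_congr rfl fun x _ => ?_
  rw [integral_finsetSum _ fun a _ => hint x a]
  refine Finset.sum_congr rfl fun a _ => ?_
  rw [integral_indicator_mul_of_condExp hM (AEBdd.indicator_preimage hA a) (hsamp a) (hi x a)]
  refine integral_congr_ae (Filter.Eventually.of_forall fun ω => ?_)
  by_cases h : X ω = x
  · simp [h]
  · simp [Set.indicator, h]

include hind hπ hsamp in
lemma integral_apply_eq {F : Fin K → 𝒳 → Ω → ℝ} (hF : ∀ a x, AEBdd m μ (F a x)) :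
    ∫ ω, F (A ω) (X ω) ω ∂μ =
      ∫ ω, ∑ x, (μ.map X).real {x} * ∑ a, π ω x a * F a x ω ∂μ := by
  rw [integral_apply_eq_sum_policy hm hX hA hε hsamp fun a x =>
    (hF a x).mono (le_sup_left.trans le_sup_left)]
  have hi : ∀ x a, AEBdd m μ fun ω => π ω x a * F a x ω := fun x a => (hπ x a).mul (hF a x)
  rw [integral_finsetSum _ fun x _ =>
    (AEBdd.const_mul _ (AEBdd.sum fun a _ => (hi x a).mono hm)).integrable]
  refine Finset.sum_congr rfl fun x _ => ?_
  rw [integral_const_mul, integral_finsetSum _ fun a _ => ((hi x a).mono hm).integrable,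
    Finset.mul_sum]
  refine Finset.sum_congr rfl fun a _ => ?_
  rw [← integral_indicator_mul_of_indep hm hX hind (hi x a) x]
  exact integral_congr_ae (Filter.Eventually.of_forall fun ω => by ring)

include hnoise hπ hsamp in
-- The noise is centred given history and context only, so the indicator of the arm is first
-- replaced by its conditional probability, which is a function of these two.
lemma integral_noise_mul_apply {F : Fin K → 𝒳 → Ω → ℝ} (hF : ∀ a x, AEBdd m μ (F a x)) :
    ∫ ω, ε (A ω) ω * F (A ω) (X ω) ω ∂μ = 0 := by
  have hεm : ∀ a, AEBdd (m ⊔ MeasurableSpace.comap X inferInstance ⊔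
          ⨆ b, MeasurableSpace.comap (ε b) inferInstance) μ (ε a) := fun a =>
    ⟨(comap_measurable (ε a)).mono ((le_iSup (fun b => MeasurableSpace.comap (ε b) inferInstance)
      a).trans le_sup_right) le_rfl, (hε a).2⟩
  rw [integral_apply_eq_sum_policy (F := fun a x ω => ε a ω * F a x ω) hm hX hA hε hsamp fun a x =>
    (hεm a).mul ((hF a x).mono (le_sup_left.trans le_sup_left))]
  refine Finset.sum_eq_zero fun x _ => Finset.sum_eq_zero fun a _ => ?_
  have hXM : Measurable[m ⊔ MeasurableSpace.comap X inferInstance] X :=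
    (comap_measurable X).mono le_sup_right le_rfl
  have h1 := integral_indicator_mul_of_condExp (sup_le hm hX.comap_le) (hε a) (hnoise a)
    (((hπ x a).mono le_sup_left).mul ((AEBdd.indicator_preimage hXM x).mul
      ((hF a x).mono le_sup_left)))
  simp only [Pi.zero_apply, zero_mul, integral_zero] at h1
  rw [← h1]
  exact integral_congr_ae (Filter.Eventually.of_forall fun ω => by ring)

end Round

/-! ### Learning and exploration rates -/

section Rates

variable {d K : ℕ} {L lam : ℝ} (hd : 1 ≤ d) (hK : 1 ≤ K) (hL : 1 ≤ L) (hl : 0 < lam)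

lemma rpow_quarter_sq (K : ℕ) : ((K : ℝ) ^ (1 / 4 : ℝ)) ^ 2 = √K := by
  rw [← Real.rpow_natCast, ← Real.rpow_mul (Nat.cast_nonneg K), Real.sqrt_eq_rpow]
  norm_num

include hK in
lemma one_le_rpow_quarter : 1 ≤ (K : ℝ) ^ (1 / 4 : ℝ) :=
  Real.one_le_rpow (by exact_mod_cast hK) (by norm_num)

include hd hK hL hl in
lemma learningRate_pos {t : ℕ} (ht : 1 ≤ t) : 0 < learningRate d K L lam t := by
  have := one_le_rpow_quarter hK
  have : (0 : ℝ) < d * t := by positivity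
  unfold learningRate
  refine lt_min (by positivity) ?_
  have : 0 < lam / L := by positivity
  positivity

include hd hK hL hl in
lemma explorationRate_pos {t : ℕ} (ht : 1 ≤ t) : 0 < explorationRate d K L lam t := by
  have := learningRate_pos hd hK hL hl ht
  unfold explorationRate
  positivity

include hd hK hL hl in
-- The cap `(1/16) √(lam / L)` on the learning rate is made for this: `128 / 16² = 1/2`.
lemma explorationRate_le_half {t : ℕ} (ht : 1 ≤ t) : explorationRate d K L lam t ≤ 1 / 2 := by
  have h0 := learningRate_pos hd hK hL hl ht
  have h1 : learningRate d K L lam t ≤ 1 / 16 * √(lam / L) := min_le_right _ _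
  have h2 : learningRate d K L lam t ^ 2 ≤ (1 / 16 * √(lam / L)) ^ 2 := by gcongr
  rw [mul_pow, Real.sq_sqrt (by positivity)] at h2
  rw [explorationRate, div_le_iff₀ hl]
  calc 128 * L * learningRate d K L lam t ^ 2 ≤ 128 * L * ((1 / 16) ^ 2 * (lam / L)) := by gcongr
    _ = 1 / 2 * lam := by field_simp; norm_num

include hd hK hL hl in
lemma explorationRate_le {t : ℕ} (ht : 1 ≤ t) :
    explorationRate d K L lam t ≤ 128 * (√K * L / (lam * d)) * (1 / t) := by
  have h0 := learningRate_pos hd hK hL hl ht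
  have h1 : learningRate d K L lam t ≤ (K : ℝ) ^ (1 / 4 : ℝ) / √((d : ℝ) * t) := min_le_left _ _
  have h2 : learningRate d K L lam t ^ 2 ≤ ((K : ℝ) ^ (1 / 4 : ℝ) / √((d : ℝ) * t)) ^ 2 := by gcongr
  rw [div_pow, rpow_quarter_sq, Real.sq_sqrt (by positivity)] at h2
  rw [explorationRate, div_le_iff₀ hl]
  calc 128 * L * learningRate d K L lam t ^ 2 ≤ 128 * L * (√K / (d * t)) := by gcongr
    _ = _ := by field_simp

lemma invLearningRate_zero : invLearningRate d K L lam 0 = 0 := by simp [invLearningRate]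

include hd hK hL hl in
lemma invLearningRate_eq {t : ℕ} (ht : 1 ≤ t) :
    invLearningRate d K L lam t = max (√d / (K : ℝ) ^ (1 / 4 : ℝ) * √t) (16 * √(L / lam)) := by
  have hk := one_le_rpow_quarter hK
  have hk' : 0 < (K : ℝ) ^ (1 / 4 : ℝ) := by linarith
  have hdt : 0 < √((d : ℝ) * t) := Real.sqrt_pos.2 (by positivity)
  have hll : 0 < √(lam / L) := Real.sqrt_pos.2 (by positivity)
  have h1 : √d / (K : ℝ) ^ (1 / 4 : ℝ) * √t = ((K : ℝ) ^ (1 / 4 : ℝ) / √((d : ℝ) * t))⁻¹ := by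
    rw [inv_div, Real.sqrt_mul (Nat.cast_nonneg d)]
    ring
  have h2 : 16 * √(L / lam) = (1 / 16 * √(lam / L))⁻¹ := by
    rw [mul_inv, ← Real.sqrt_inv, inv_div]
    norm_num
  rw [h1, h2, invLearningRate, if_neg (by omega), learningRate, one_div]
  rcases le_total ((K : ℝ) ^ (1 / 4 : ℝ) / √((d : ℝ) * t)) (1 / 16 * √(lam / L)) with h | h
  · rw [min_eq_left h, max_eq_left]
    exact inv_anti₀ (by positivity) h
  · rw [min_eq_right h, max_eq_right]
    exact inv_anti₀ (by positivity) h

include hd hK hL hl in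
lemma invLearningRate_pos {t : ℕ} (ht : 1 ≤ t) : 0 < invLearningRate d K L lam t := by
  rw [invLearningRate, if_neg (by omega)]
  exact one_div_pos.2 (learningRate_pos hd hK hL hl ht)

include hd hK hL hl in
lemma invLearningRate_pred_le {t : ℕ} (ht : 1 ≤ t) :
    invLearningRate d K L lam (t - 1) ≤ invLearningRate d K L lam t := by
  rcases ht.eq_or_lt with rfl | ht
  · simpa [invLearningRate_zero] using (invLearningRate_pos hd hK hL hl le_rfl).le
  · have hk := one_le_rpow_quarter hK
    rw [invLearningRate_eq hd hK hL hl (by omega), invLearningRate_eq hd hK hL hl (by omega)]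
    gcongr
    omega

lemma sqrt_le_sqrt_two_mul_sqrt_pred {t : ℕ} (ht : 2 ≤ t) : √(t : ℝ) ≤ √2 * √((t - 1 : ℕ) : ℝ) := by
  rw [← Real.sqrt_mul (by norm_num)]
  apply Real.sqrt_le_sqrt
  have : t ≤ 2 * (t - 1) := by omega
  exact_mod_cast this

include hd hK hL hl in
lemma invLearningRate_le_pred {t : ℕ} (ht : 2 ≤ t) :
    invLearningRate d K L lam t ≤ 2 * invLearningRate d K L lam (t - 1) := by
  have hk := one_le_rpow_quarter hK
  have h2 : √2 ≤ 2 := Real.sqrt_le_iff.2 (by norm_num)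
  rw [invLearningRate_eq hd hK hL hl (by omega), invLearningRate_eq hd hK hL hl (by omega),
    mul_max_of_nonneg _ _ (by norm_num)]
  apply max_le_max
  · calc √d / (K : ℝ) ^ (1 / 4 : ℝ) * √t
        ≤ √d / (K : ℝ) ^ (1 / 4 : ℝ) * (2 * √((t - 1 : ℕ) : ℝ)) := by
          gcongr
          exact (sqrt_le_sqrt_two_mul_sqrt_pred ht).trans (by gcongr)
      _ = _ := by ring
  · have : 0 ≤ √(L / lam) := Real.sqrt_nonneg _
    linarith

include hd hK hL hl in
-- The denominator uses `t + 1` because the penalty of round `t` is weighted by the deviation of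
-- `q_{t+1}`.
lemma invLearningRate_sub_le {t : ℕ} (ht : 2 ≤ t) :
    invLearningRate d K L lam t - invLearningRate d K L lam (t - 1) ≤
      2 * (√d / (K : ℝ) ^ (1 / 4 : ℝ)) / √((t + 1 : ℕ) : ℝ) := by
  have hk := one_le_rpow_quarter hK
  rw [invLearningRate_eq hd hK hL hl (by omega), invLearningRate_eq hd hK hL hl (by omega)]
  set c := √d / (K : ℝ) ^ (1 / 4 : ℝ) with hc
  have hc0 : 0 ≤ c := by positivity
  obtain ⟨s, rfl⟩ : ∃ s, t = s + 1 := ⟨t - 1, by omega⟩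
  have h1 : √((s + 1 : ℕ) : ℝ) - √(s : ℝ) ≤ 2 / √((s + 1 + 1 : ℕ) : ℝ) := by
    have hs : (1 : ℝ) ≤ s := by exact_mod_cast (by omega : 1 ≤ s)
    have hpos : 0 < √((s + 1 + 1 : ℕ) : ℝ) := Real.sqrt_pos.2 (by positivity)
    rw [le_div_iff₀ hpos]
    have a1 := Real.sq_sqrt (Nat.cast_nonneg (α := ℝ) (s + 1))
    have a2 := Real.sq_sqrt (Nat.cast_nonneg (α := ℝ) s)
    have a3 : √((s + 1 + 1 : ℕ) : ℝ) ≤ 2 * √((s + 1 : ℕ) : ℝ) := by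
      apply Real.sqrt_le_iff.2 ⟨by positivity, ?_⟩
      rw [mul_pow, a1]
      push_cast
      linarith
    have a4 : √(s : ℝ) ≤ √((s + 1 : ℕ) : ℝ) := Real.sqrt_le_sqrt (by push_cast; linarith)
    push_cast at a1 a2 a3 a4 ⊢
    have a5 := Real.sqrt_nonneg (s : ℝ)
    nlinarith
  have h2 : c * √((s + 1 : ℕ) : ℝ) - c * √(s : ℝ) ≤ 2 * c / √((s + 1 + 1 : ℕ) : ℝ) := by
    rw [← mul_sub]
    calc _ ≤ c * (2 / √((s + 1 + 1 : ℕ) : ℝ)) := by gcongr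
      _ = _ := by ring
  have h3 : 0 ≤ 2 * c / √((s + 1 + 1 : ℕ) : ℝ) := by positivity
  simp only [Nat.add_sub_cancel]
  rw [sub_le_iff_le_add]
  -- A maximum with a constant grows by no more than its moving argument.
  apply max_le
  · linarith [le_max_left (c * √(s : ℝ)) (16 * √(L / lam))]
  · linarith [le_max_right (c * √(s : ℝ)) (16 * √(L / lam))]

include hd hK hL hl in
lemma one_div_invLearningRate_pred_le {t : ℕ} (ht : 2 ≤ t) :
    1 / invLearningRate d K L lam (t - 1) ≤ 2 * ((K : ℝ) ^ (1 / 4 : ℝ) / √d) / √t := by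
  have hk := one_le_rpow_quarter hK
  have h0 := invLearningRate_pos hd hK hL hl (t := t - 1) (by omega)
  have h1 : √d / (K : ℝ) ^ (1 / 4 : ℝ) * √((t - 1 : ℕ) : ℝ) ≤ invLearningRate d K L lam (t - 1) := by
    rw [invLearningRate_eq hd hK hL hl (by omega)]
    exact le_max_left _ _
  have hd0 : 0 < √(d : ℝ) := Real.sqrt_pos.2 (by exact_mod_cast hd)
  have ht0 : 0 < √(t : ℝ) := Real.sqrt_pos.2 (by exact_mod_cast (by omega : 0 < t))
  have hk0 : 0 < (K : ℝ) ^ (1 / 4 : ℝ) := by linarith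
  have h2 : √2 ≤ 2 := Real.sqrt_le_iff.2 (by norm_num)
  have h3 : √(t : ℝ) ≤ 2 * √((t - 1 : ℕ) : ℝ) :=
    (sqrt_le_sqrt_two_mul_sqrt_pred ht).trans (by gcongr)
  rw [div_le_div_iff₀ h0 ht0]
  calc 1 * √(t : ℝ) ≤ 2 * √((t - 1 : ℕ) : ℝ) := by linarith
    _ = 2 * ((K : ℝ) ^ (1 / 4 : ℝ) / √d) * (√d / (K : ℝ) ^ (1 / 4 : ℝ) * √((t - 1 : ℕ) : ℝ)) := by
      field_simp
    _ ≤ _ := by gcongr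

include hd hK hL hl in
lemma invLearningRate_one_le (hdl : (d : ℝ) ≤ 1 / lam) :
    invLearningRate d K L lam 1 ≤ 17 * √(L / lam) := by
  have hk := one_le_rpow_quarter hK
  have h0 : 0 ≤ √(L / lam) := Real.sqrt_nonneg _
  rw [invLearningRate_eq hd hK hL hl le_rfl]
  apply max_le
  · have h1 : √(d : ℝ) ≤ √(L / lam) := by
      apply Real.sqrt_le_sqrt
      refine hdl.trans ?_
      gcongr
    calc √d / (K : ℝ) ^ (1 / 4 : ℝ) * √((1 : ℕ) : ℝ) ≤ √d / 1 * 1 := by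
          gcongr
          simp
      _ ≤ _ := by linarith
  · linarith

end Rates

/-! ### Runs of the algorithm -/

section Run

variable {𝒳 Ω : Type*} [Fintype 𝒳] [MeasurableSpace 𝒳] [MeasurableSingletonClass 𝒳]
  [MeasurableSpace Ω]

/-- A run of the `1/2`-LC-Tsallis-INF in a stochastic environment with finitely many contexts. -/
structure IsRun {d K : ℕ} (P : Problem 𝒳 d K) (L lam : ℝ) (e : 𝒳 → Fin K → ℝ) (μ : Measure Ω)
    (T : ℕ) (q : ℕ → Ω → 𝒳 → Fin K → ℝ) (X : ℕ → Ω → 𝒳) (A : ℕ → Ω → Fin K)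
    (ε : ℕ → Fin K → Ω → ℝ) : Prop where
  one_le_d : 1 ≤ d
  support : P.FiniteSupport L
  explore : P.IsExplorationPolicy lam e
  env : P.IsStochasticEnvironment μ T X A ε
  plays : P.PlaysLCTsallisINF (1 / 2) L lam e μ T q X A ε

/-- The mean loss `⟨φ(a, x), θ₀⟩`. -/
def Problem.meanLoss {d K : ℕ} (P : Problem 𝒳 d K) (a : Fin K) (x : 𝒳) : ℝ := P.φ a x ⬝ᵥ P.θ₀

/-- `φ(a, x)ᵀ Σ_t⁻¹ φ(b, y)`. -/
noncomputable def Problem.invForm {d K : ℕ} (P : Problem 𝒳 d K) (L lam : ℝ) (e : 𝒳 → Fin K → ℝ)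
    (q : ℕ → Ω → 𝒳 → Fin K → ℝ) (t : ℕ) (ω : Ω) (a : Fin K) (x : 𝒳) (b : Fin K) (y : 𝒳) : ℝ :=
  P.φ a x ⬝ᵥ ((P.cov (policy L lam d e q t ω))⁻¹ *ᵥ P.φ b y)

omit [Fintype 𝒳] [MeasurableSingletonClass 𝒳] in
lemma Problem.abs_meanLoss_le {d K : ℕ} (P : Problem 𝒳 d K) (a : Fin K) (x : 𝒳) :
    |P.meanLoss a x| ≤ 1 :=
  P.abs_dotProduct_le_one _ (P.φ_mem a x) _ P.θ₀_mem

namespace IsRun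

variable {d K : ℕ} {P : Problem 𝒳 d K} {L lam : ℝ} {e : 𝒳 → Fin K → ℝ} {μ : Measure Ω}
  {T : ℕ} {q : ℕ → Ω → 𝒳 → Fin K → ℝ} {X : ℕ → Ω → 𝒳} {A : ℕ → Ω → Fin K}
  {ε : ℕ → Fin K → Ω → ℝ} (H : IsRun P L lam e μ T q X A ε)
include H

lemma nonempty : Nonempty 𝒳 := by
  have := P.isProbabilityMeasure_G
  exact P.G.nonempty_of_neZero

lemma one_le_L : 1 ≤ L := by
  have := H.nonempty
  have h1 : (1 : ℝ) ≤ Fintype.card 𝒳 := by exact_mod_cast Fintype.card_pos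
  exact h1.trans H.support.1

lemma one_le_K : 1 ≤ K := by
  obtain ⟨x⟩ := H.nonempty
  by_contra! h
  obtain rfl : K = 0 := by omega
  simpa using (H.explore.mem_simplex x).2

lemma lam_pos : 0 < lam := H.explore.lam_pos

lemma g_pos (x : 𝒳) : 0 < P.g x := by
  have := H.one_le_L
  exact lt_of_lt_of_le (by positivity) (H.support.2 x)

lemma natCast_d_le : (d : ℝ) ≤ 1 / lam := H.explore.natCast_le

variable {t : ℕ}

lemma rate_pos (ht : 1 ≤ t) : 0 < explorationRate d K L lam t :=
  explorationRate_pos H.one_le_d H.one_le_K H.one_le_L H.lam_pos ht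

lemma rate_le_half (ht : 1 ≤ t) : explorationRate d K L lam t ≤ 1 / 2 :=
  explorationRate_le_half H.one_le_d H.one_le_K H.one_le_L H.lam_pos ht

lemma one_div_rate_mul_lam (ht : 1 ≤ t) :
    1 / (explorationRate d K L lam t * lam) = invLearningRate d K L lam t ^ 2 / (128 * L) := by
  have h1 := learningRate_pos H.one_le_d H.one_le_K H.one_le_L H.lam_pos ht
  have h2 := H.one_le_L
  have h3 := H.lam_pos
  rw [explorationRate, invLearningRate, if_neg (by omega)]
  field_simp

section Pointwise

variable (ht : t ∈ Finset.Icc 1 T) (ω : Ω)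
include ht

lemma q_nonneg (x : 𝒳) (a : Fin K) : 0 ≤ q t ω x a := (H.plays.mem_simplex t ht ω x).1 a

lemma q_le_one (x : 𝒳) (a : Fin K) : q t ω x a ≤ 1 :=
  (H.plays.mem_simplex t ht ω x).2 ▸ Finset.single_le_sum (fun i _ => H.q_nonneg ht ω x i)
    (Finset.mem_univ a)

lemma rate_mul_le_policy (x : 𝒳) (a : Fin K) :
    explorationRate d K L lam t * e x a ≤ policy L lam d e q t ω x a := by
  have h1 := H.rate_le_half (Finset.mem_Icc.1 ht).1
  have h2 := H.q_nonneg ht ω x a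
  unfold policy
  nlinarith

lemma half_mul_le_policy (x : 𝒳) (a : Fin K) :
    1 / 2 * q t ω x a ≤ policy L lam d e q t ω x a := by
  have h0 := H.rate_pos (Finset.mem_Icc.1 ht).1
  have h1 := H.rate_le_half (Finset.mem_Icc.1 ht).1
  have h2 := H.q_nonneg ht ω x a
  have h3 := (H.explore.mem_simplex x).1 a
  unfold policy
  nlinarith

lemma policy_nonneg (x : 𝒳) (a : Fin K) : 0 ≤ policy L lam d e q t ω x a := by
  linarith [H.half_mul_le_policy ht ω x a, H.q_nonneg ht ω x a]

lemma sum_policy (x : 𝒳) : ∑ a, policy L lam d e q t ω x a = 1 := by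
  simp only [policy, Finset.sum_add_distrib, ← Finset.mul_sum,
    (H.plays.mem_simplex t ht ω x).2, (H.explore.mem_simplex x).2]
  ring

lemma isUnit_cov : IsUnit (P.cov (policy L lam d e q t ω)) :=
  H.explore.isUnit_cov_of_le (H.rate_pos (Finset.mem_Icc.1 ht).1) (H.rate_mul_le_policy ht ω)

lemma invForm_nonneg (a : Fin K) (x : 𝒳) : 0 ≤ P.invForm L lam e q t ω a x a x :=
  Problem.inv_nonneg (H.isUnit_cov ht ω) (H.policy_nonneg ht ω) _

lemma invForm_self_le (a : Fin K) (x : 𝒳) :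
    P.invForm L lam e q t ω a x a x ≤ invLearningRate d K L lam t ^ 2 / (128 * L) := by
  rw [← H.one_div_rate_mul_lam (Finset.mem_Icc.1 ht).1]
  exact H.explore.inv_self_le (H.rate_pos (Finset.mem_Icc.1 ht).1) (H.rate_mul_le_policy ht ω)
    (P.φ_mem a x)

lemma invForm_sq_le (a : Fin K) (x : 𝒳) (b : Fin K) (y : 𝒳) :
    P.invForm L lam e q t ω a x b y ^ 2 ≤
      P.invForm L lam e q t ω a x a x * P.invForm L lam e q t ω b y b y :=
  Problem.inv_cauchy_schwarz (H.isUnit_cov ht ω) (H.policy_nonneg ht ω) _ _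

lemma abs_invForm_le (a : Fin K) (x : 𝒳) (b : Fin K) (y : 𝒳) :
    |P.invForm L lam e q t ω a x b y| ≤ invLearningRate d K L lam t ^ 2 / (128 * L) := by
  have hL := H.one_le_L
  apply abs_le_of_sq_le_sq _ (by positivity)
  rw [sq (_ / _)]
  exact (H.invForm_sq_le ht ω a x b y).trans (mul_le_mul (H.invForm_self_le ht ω a x)
    (H.invForm_self_le ht ω b y) (H.invForm_nonneg ht ω b y) (by positivity))

lemma q_mul_invForm_le (a : Fin K) (x : 𝒳) :
    q t ω x a * P.invForm L lam e q t ω a x a x ≤ 2 * L := by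
  have h1 := Problem.mul_inv_self_le_one (H.isUnit_cov ht ω) (H.policy_nonneg ht ω) a x
  change P.g x * _ * P.invForm L lam e q t ω a x a x ≤ 1 at h1
  have h2 := H.half_mul_le_policy ht ω x a
  have h3 := H.support.2 x
  have h4 := H.invForm_nonneg ht ω a x
  have h5 := H.q_nonneg ht ω x a
  have hL := H.one_le_L
  have h6 : 1 / L * (1 / 2 * q t ω x a) * P.invForm L lam e q t ω a x a x ≤ 1 := by
    refine le_trans ?_ h1
    gcongr
    exact P.g_nonneg x
  calc _ = 2 * L * (1 / L * (1 / 2 * q t ω x a) * P.invForm L lam e q t ω a x a x) := by field_simp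
    _ ≤ 2 * L * 1 := by gcongr
    _ = _ := by ring

/-- By Cauchy–Schwarz for `Σ_t⁻¹` the square is at most `2 L · r² / (128 L) = r² / 64` with `r = 1 /
η_t`. The constant `128` in `γ_t` is chosen for this. -/
lemma sqrt_q_mul_abs_invForm_le (a : Fin K) (x : 𝒳) (b : Fin K) (y : 𝒳) :
    √(q t ω x a) * |P.invForm L lam e q t ω a x b y| ≤ invLearningRate d K L lam t / 8 := by
  have hL := H.one_le_L
  have hr := invLearningRate_pos H.one_le_d H.one_le_K H.one_le_L H.lam_pos (Finset.mem_Icc.1 ht).1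
  apply le_of_sq_le_sq _ (by positivity)
  rw [mul_pow, Real.sq_sqrt (H.q_nonneg ht ω x a), sq_abs]
  have h5 := H.q_nonneg ht ω x a
  calc _ ≤ q t ω x a * (P.invForm L lam e q t ω a x a x * P.invForm L lam e q t ω b y b y) := by
        gcongr
        exact H.invForm_sq_le ht ω a x b y
    _ = q t ω x a * P.invForm L lam e q t ω a x a x * P.invForm L lam e q t ω b y b y := by ring
    _ ≤ 2 * L * (invLearningRate d K L lam t ^ 2 / (128 * L)) :=
        mul_le_mul (H.q_mul_invForm_le ht ω a x) (H.invForm_self_le ht ω b y)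
          (H.invForm_nonneg ht ω b y) (by positivity)
    _ = _ := by field_simp; norm_num

lemma sum_q_mul_invForm_le :
    ∑ x, P.g x * ∑ a, q t ω x a * P.invForm L lam e q t ω a x a x ≤ 2 * d := by
  have h1 := Problem.sum_inv_self (H.isUnit_cov ht ω)
  change ∑ x, P.g x * ∑ a, _ * P.invForm L lam e q t ω a x a x = (d : ℝ) at h1
  rw [← h1, Finset.mul_sum]
  refine Finset.sum_le_sum fun x _ => ?_
  rw [mul_left_comm]
  refine mul_le_mul_of_nonneg_left ?_ (P.g_nonneg x)
  rw [Finset.mul_sum]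
  refine Finset.sum_le_sum fun a _ => ?_
  have h2 := H.half_mul_le_policy ht ω x a
  have h4 := H.invForm_nonneg ht ω a x
  nlinarith

/-- The variance of the loss estimators, weighted by the square root of the probability of the
suboptimal arms. -/
lemma sum_sqrt_mul_invForm_le (ρ : 𝒳 → Fin K) :
    ∑ x, P.g x * (√(1 - q t ω x (ρ x)) * ∑ a, q t ω x a * P.invForm L lam e q t ω a x a x) ≤
      2 * (d * √L) * √(∑ x, P.g x * (1 - q t ω x (ρ x))) := by
  set v : 𝒳 → ℝ := fun x => ∑ a, q t ω x a * P.invForm L lam e q t ω a x a x with hv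
  have hL := H.one_le_L
  have hv0 : ∀ x, 0 ≤ v x := fun x => Finset.sum_nonneg fun a _ =>
    mul_nonneg (H.q_nonneg ht ω x a) (H.invForm_nonneg ht ω a x)
  have hsum : ∑ x, P.g x * v x ≤ 2 * d := H.sum_q_mul_invForm_le ht ω
  -- One context carries at most the whole average `2 d`, and its weight is at least `1 / L`.
  have hvle : ∀ x, v x ≤ 2 * d * L := by
    intro x
    have h1 : P.g x * v x ≤ 2 * d := le_trans (Finset.single_le_sum (f := fun x => P.g x * v x)
      (fun y _ => mul_nonneg (P.g_nonneg y) (hv0 y)) (Finset.mem_univ x)) hsum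
    have h2 : 1 / L * v x ≤ 2 * d :=
      (mul_le_mul_of_nonneg_right (H.support.2 x) (hv0 x)).trans h1
    calc v x = 1 / L * v x * L := by field_simp
      _ ≤ _ := by gcongr
  have hw : ∀ x, 0 ≤ 1 - q t ω x (ρ x) := fun x => by linarith [H.q_le_one ht ω x (ρ x)]
  -- Cauchy–Schwarz with weights `g` leaves `∑ g v²`, at most `max v · ∑ g v ≤ 2 d L · 2 d`.
  have hcs := Finset.sum_mul_sq_le_sq_mul_sq Finset.univ
    (fun x => √(P.g x) * √(1 - q t ω x (ρ x))) (fun x => √(P.g x) * v x)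
  simp only [mul_pow, Real.sq_sqrt (P.g_nonneg _), Real.sq_sqrt (hw _)] at hcs
  have hR : 2 * (d * √L) * √(∑ x, P.g x * (1 - q t ω x (ρ x))) =
      √((∑ x, P.g x * (1 - q t ω x (ρ x))) * (2 * d * L * (2 * d))) := by
    rw [Real.sqrt_mul (Finset.sum_nonneg fun x _ => mul_nonneg (P.g_nonneg x) (hw x)),
      show 2 * (d : ℝ) * L * (2 * d) = (2 * d) ^ 2 * L by ring, Real.sqrt_mul (by positivity),
      Real.sqrt_sq (by positivity)]
    ring
  rw [hR]
  apply Real.le_sqrt_of_sq_le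
  have h3 : ∑ x, P.g x * (√(1 - q t ω x (ρ x)) * v x) =
      ∑ x, √(P.g x) * √(1 - q t ω x (ρ x)) * (√(P.g x) * v x) := by
    refine Finset.sum_congr rfl fun x _ => ?_
    nth_rewrite 1 [← Real.mul_self_sqrt (P.g_nonneg x)]
    ring
  rw [h3]
  refine hcs.trans ?_
  refine mul_le_mul_of_nonneg_left ?_ (Finset.sum_nonneg fun x _ => mul_nonneg (P.g_nonneg x) (hw x))
  calc ∑ x, P.g x * v x ^ 2 ≤ ∑ x, 2 * d * L * (P.g x * v x) := by
        refine Finset.sum_le_sum fun x _ => ?_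
        have := mul_le_mul_of_nonneg_left (hvle x) (mul_nonneg (P.g_nonneg x) (hv0 x))
        nlinarith
    _ ≤ _ := by
        rw [← Finset.mul_sum]
        gcongr

end Pointwise

end IsRun

end Run

/-- The inverse is `det⁻¹` times the adjugate, both built from polynomials in the entries; with `0⁻¹
= 0` no invertibility is needed. -/
lemma measurable_dotProduct_inv_mulVec {Ω : Type*} {m : MeasurableSpace Ω} {d : ℕ}
    {S : Ω → Matrix (Fin d) (Fin d) ℝ} (hS : ∀ i j, Measurable fun ω => S ω i j) (u v : Fin d → ℝ) :
    Measurable fun ω => u ⬝ᵥ ((S ω)⁻¹ *ᵥ v) := by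
  have hS' : Measurable fun ω => (fun i j => S ω i j : Fin d → Fin d → ℝ) :=
    measurable_pi_lambda _ fun i => measurable_pi_lambda _ fun j => hS i j
  have h1 : Continuous fun B : Fin d → Fin d → ℝ => (Matrix.of B).det :=
    Continuous.matrix_det continuous_id
  have h2 : Continuous fun B : Fin d → Fin d → ℝ => u ⬝ᵥ ((Matrix.of B).adjugate *ᵥ v) :=
    continuous_const.dotProduct ((Continuous.matrix_adjugate continuous_id).matrix_mulVec
      continuous_const)
  have h3 := (h1.measurable.comp hS').inv.mul (h2.measurable.comp hS')
  convert h3 using 2 with ω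
  simp only [Matrix.inv_def, Ring.inverse_eq_inv', Matrix.smul_mulVec, dotProduct_smul, smul_eq_mul]
  rfl

/-! ### Conditional moments of the loss estimator -/

namespace IsRun

variable {𝒳 Ω : Type*} [Fintype 𝒳] [MeasurableSpace 𝒳] [MeasurableSingletonClass 𝒳]
  [mΩ : MeasurableSpace Ω] {d K : ℕ} {P : Problem 𝒳 d K} {L lam : ℝ} {e : 𝒳 → Fin K → ℝ}
  {μ : Measure Ω} [IsProbabilityMeasure μ]
  {T : ℕ} {q : ℕ → Ω → 𝒳 → Fin K → ℝ} {X : ℕ → Ω → 𝒳} {A : ℕ → Ω → Fin K}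
  {ε : ℕ → Fin K → Ω → ℝ} (H : IsRun P L lam e μ T q X A ε) {t : ℕ} (ht : t ∈ Finset.Icc 1 T)
include H ht

lemma aebdd_noise (a : Fin K) : AEBdd mΩ μ (ε t a) := by
  refine ⟨H.env.measurable_ε t ht a, 2, ?_⟩
  obtain ⟨x⟩ := H.nonempty
  filter_upwards [H.env.loss_bounded t ht a x] with ω h
  have h1 := P.abs_meanLoss_le a x
  have h2 : ε t a ω = P.loss ε t a x ω - P.meanLoss a x := by
    simp [Problem.loss, Problem.meanLoss]
  rw [h2]
  exact (abs_sub _ _).trans (by linarith)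

lemma aebdd_loss (a : Fin K) (x : 𝒳) : AEBdd mΩ μ (P.loss ε t a x) :=
  (AEBdd.const _).add (H.aebdd_noise ht a)

lemma aebdd_loss_apply : AEBdd mΩ μ fun ω => P.loss ε t (A t ω) (X t ω) ω :=
  AEBdd.apply (F := fun a x ω => P.loss ε t a x ω) (H.env.measurable_A t ht)
    (H.env.measurable_X t ht) (H.aebdd_loss ht)

lemma abs_loss_apply_le : ∀ᵐ ω ∂μ, |P.loss ε t (A t ω) (X t ω) ω| ≤ 1 := by
  have h : ∀ᵐ ω ∂μ, ∀ a x, |P.loss ε t a x ω| ≤ 1 :=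
    ae_all_iff.2 fun a => ae_all_iff.2 fun x => H.env.loss_bounded t ht a x
  filter_upwards [h] with ω hω
  exact hω _ _

lemma history_le : P.history X A ε (t - 1) ≤ mΩ := by
  refine iSup₂_le fun s hs => ?_
  have hs' : s ∈ Finset.Icc 1 T := by
    rw [Finset.mem_Icc] at *
    omega
  exact ((H.env.measurable_X s hs').prodMk ((H.env.measurable_A s hs').prodMk
    (H.aebdd_loss_apply hs').1)).comap_le

lemma aebdd_q (x : 𝒳) (a : Fin K) : AEBdd (P.history X A ε (t - 1)) μ fun ω => q t ω x a :=
  .of_forall (H.plays.adapted t ht x a) (C := 1) fun ω =>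
    abs_le.2 ⟨by linarith [H.q_nonneg ht ω x a], H.q_le_one ht ω x a⟩

lemma aebdd_policy (x : 𝒳) (a : Fin K) :
    AEBdd (P.history X A ε (t - 1)) μ fun ω => policy L lam d e q t ω x a :=
  ((H.aebdd_q ht x a).const_mul _).add (AEBdd.const _)

lemma aebdd_invForm (a : Fin K) (x : 𝒳) (b : Fin K) (y : 𝒳) :
    AEBdd (P.history X A ε (t - 1)) μ fun ω => P.invForm L lam e q t ω a x b y := by
  refine .of_forall (measurable_dotProduct_inv_mulVec (fun i j => ?_) _ _)
    (fun ω => H.abs_invForm_le ht ω a x b y)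
  simp only [Problem.cov, Matrix.sum_apply, Matrix.smul_apply, smul_eq_mul]
  exact (AEBdd.sum fun x _ => (AEBdd.sum fun a _ =>
    (H.aebdd_policy ht x a).mul (AEBdd.const _)).const_mul _).1

omit ht in
lemma estimator_dotProduct (ω : Ω) (a : Fin K) (x : 𝒳) :
    P.estimator L lam e q X A ε t ω ⬝ᵥ P.φ a x =
      P.loss ε t (A t ω) (X t ω) ω * P.invForm L lam e q t ω a x (A t ω) (X t ω) := by
  rw [Problem.estimator, smul_dotProduct, smul_eq_mul, dotProduct_comm _ (P.φ a x)]
  rfl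

lemma aebdd_estimator (a : Fin K) (x : 𝒳) :
    AEBdd mΩ μ fun ω => P.estimator L lam e q X A ε t ω ⬝ᵥ P.φ a x := by
  simp only [H.estimator_dotProduct]
  exact (H.aebdd_loss_apply ht).mul (AEBdd.apply
    (F := fun b y ω => P.invForm L lam e q t ω a x b y) (H.env.measurable_A t ht)
    (H.env.measurable_X t ht) fun b y => (H.aebdd_invForm ht a x b y).mono (H.history_le ht))

lemma integral_apply {F : Fin K → 𝒳 → Ω → ℝ}
    (hF : ∀ a x, AEBdd (P.history X A ε (t - 1)) μ (F a x)) :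
    ∫ ω, F (A t ω) (X t ω) ω ∂μ =
      ∫ ω, ∑ x, P.g x * ∑ a, policy L lam d e q t ω x a * F a x ω ∂μ := by
  rw [integral_apply_eq (H.history_le ht) (H.env.measurable_X t ht) (H.env.measurable_A t ht)
    (H.aebdd_noise ht) (H.env.indep_X t ht) (H.aebdd_policy ht) (H.plays.sampling t ht) hF,
    H.env.law_X t ht]
  rfl

lemma integral_noise_apply {F : Fin K → 𝒳 → Ω → ℝ}
    (hF : ∀ a x, AEBdd (P.history X A ε (t - 1)) μ (F a x)) :
    ∫ ω, ε t (A t ω) ω * F (A t ω) (X t ω) ω ∂μ = 0 :=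
  integral_noise_mul_apply (H.history_le ht) (H.env.measurable_X t ht) (H.env.measurable_A t ht)
    (H.aebdd_noise ht) (H.env.noise_mean_zero t ht) (H.aebdd_policy ht) (H.plays.sampling t ht) hF

/-- The loss estimator is unbiased given the history. -/
lemma integral_mul_estimator {W : Ω → ℝ} (hW : AEBdd (P.history X A ε (t - 1)) μ W)
    (a : Fin K) (x : 𝒳) :
    ∫ ω, W ω * (P.estimator L lam e q X A ε t ω ⬝ᵥ P.φ a x) ∂μ = ∫ ω, W ω * P.meanLoss a x ∂μ := by
  have hF : ∀ b y, AEBdd (P.history X A ε (t - 1)) μ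
      fun ω => W ω * P.invForm L lam e q t ω a x b y := fun b y =>
    hW.mul (H.aebdd_invForm ht a x b y)
  have hG : ∀ b y, AEBdd (P.history X A ε (t - 1)) μ
      fun ω => W ω * P.invForm L lam e q t ω a x b y * P.meanLoss b y := fun b y =>
    (hF b y).mul (AEBdd.const _)
  have hmeas := H.env.measurable_A t ht
  have hmeasX := H.env.measurable_X t ht
  have hm := H.history_le ht
  have h1 := H.integral_noise_apply ht hF
  have h2 := H.integral_apply ht hG
  have hi1 : Integrable (fun ω => ε t (A t ω) ω *
      (W ω * P.invForm L lam e q t ω a x (A t ω) (X t ω))) μ :=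
    (AEBdd.apply (F := fun b y ω => ε t b ω * (W ω * P.invForm L lam e q t ω a x b y)) hmeas hmeasX
      fun b y => (H.aebdd_noise ht b).mul ((hF b y).mono hm)).integrable
  have hi2 : Integrable (fun ω => W ω * P.invForm L lam e q t ω a x (A t ω) (X t ω) *
      P.meanLoss (A t ω) (X t ω)) μ :=
    (AEBdd.apply (F := fun b y ω => W ω * P.invForm L lam e q t ω a x b y * P.meanLoss b y)
      hmeas hmeasX fun b y => (hG b y).mono hm).integrable
  -- The observed loss splits into noise, whose contribution has mean zero, and mean loss, for which
  -- `Σ_t⁻¹ Σ_t = 1` recovers `⟨φ(a, x), θ₀⟩`.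
  calc _ = ∫ ω, (ε t (A t ω) ω * (W ω * P.invForm L lam e q t ω a x (A t ω) (X t ω)) +
        W ω * P.invForm L lam e q t ω a x (A t ω) (X t ω) * P.meanLoss (A t ω) (X t ω)) ∂μ := by
        refine integral_congr_ae (Filter.Eventually.of_forall fun ω => ?_)
        simp only [H.estimator_dotProduct, Problem.loss, Problem.meanLoss]
        ring
    _ = ∫ ω, ∑ y, P.g y * ∑ b, policy L lam d e q t ω y b *
          (W ω * P.invForm L lam e q t ω a x b y * P.meanLoss b y) ∂μ := by
        rw [integral_add hi1 hi2, h1, h2, zero_add]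
    _ = _ := by
        refine integral_congr_ae (Filter.Eventually.of_forall fun ω => ?_)
        have h3 := Problem.sum_inv_mul (H.isUnit_cov ht ω) (P.φ a x) P.θ₀
        change _ = P.meanLoss a x at h3
        simp only
        rw [← h3, Finset.mul_sum]
        refine Finset.sum_congr rfl fun y _ => ?_
        rw [mul_left_comm (W ω)]
        congr 1
        rw [Finset.mul_sum]
        refine Finset.sum_congr rfl fun b _ => ?_
        simp only [Problem.invForm, Problem.meanLoss]
        ring

/-- The conditional second moment of the loss estimator. -/
lemma integral_mul_estimator_sq_le {W : Ω → ℝ} (hW : AEBdd (P.history X A ε (t - 1)) μ W)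
    (hW0 : ∀ ω, 0 ≤ W ω) (a : Fin K) (x : 𝒳) :
    ∫ ω, W ω * (P.estimator L lam e q X A ε t ω ⬝ᵥ P.φ a x) ^ 2 ∂μ ≤
      ∫ ω, W ω * P.invForm L lam e q t ω a x a x ∂μ := by
  have hF : ∀ b y, AEBdd (P.history X A ε (t - 1)) μ
      fun ω => W ω * P.invForm L lam e q t ω a x b y ^ 2 := fun b y =>
    hW.mul (H.aebdd_invForm ht a x b y).pow_two
  have hm := H.history_le ht
  have h2 := H.integral_apply ht hF
  -- The squared loss is at most `1`, and averaging `(φᵀ Σ_t⁻¹ φ(b, y))²` over `π_t` gives back `φᵀ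
  -- Σ_t⁻¹ φ`.
  calc _ ≤ ∫ ω, W ω * P.invForm L lam e q t ω a x (A t ω) (X t ω) ^ 2 ∂μ := by
        refine integral_mono_ae ((hW.mono hm).mul (H.aebdd_estimator ht a x).pow_two).integrable
          (AEBdd.apply (F := fun b y ω => W ω * P.invForm L lam e q t ω a x b y ^ 2)
            (H.env.measurable_A t ht) (H.env.measurable_X t ht)
            fun b y => (hF b y).mono hm).integrable ?_
        filter_upwards [H.abs_loss_apply_le ht] with ω hω
        simp only [H.estimator_dotProduct]
        refine mul_le_mul_of_nonneg_left ?_ (hW0 ω)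
        rw [mul_pow]
        exact mul_le_of_le_one_left (sq_nonneg _) (sq_le_one_iff_abs_le_one _ |>.2 hω)
    _ = ∫ ω, ∑ y, P.g y * ∑ b, policy L lam d e q t ω y b *
          (W ω * P.invForm L lam e q t ω a x b y ^ 2) ∂μ := h2
    _ = _ := by
        refine integral_congr_ae (Filter.Eventually.of_forall fun ω => ?_)
        have h3 := Problem.sum_inv_sq (H.isUnit_cov ht ω) (P.φ a x)
        simp only [Problem.invForm]
        rw [← h3, Finset.mul_sum]
        refine Finset.sum_congr rfl fun y _ => ?_
        rw [mul_left_comm (W ω)]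
        congr 1
        rw [Finset.mul_sum]
        exact Finset.sum_congr rfl fun b _ => by ring

lemma integral_noise_policy (ρ : 𝒳 → Fin K) : ∫ ω, ε t (ρ (X t ω)) ω ∂μ = 0 := by
  have hX := H.env.measurable_X t ht
  have hi : ∀ x, Integrable (fun ω => ε t (ρ x) ω * (X t ⁻¹' {x}).indicator (fun _ => (1 : ℝ)) ω) μ :=
    fun x => ((H.aebdd_noise ht (ρ x)).mul (AEBdd.indicator_preimage hX x)).integrable
  calc _ = ∫ ω, ∑ x, ε t (ρ x) ω * (X t ⁻¹' {x}).indicator (fun _ => (1 : ℝ)) ω ∂μ := by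
        refine integral_congr_ae (Filter.Eventually.of_forall fun ω => ?_)
        simp only
        rw [Finset.sum_eq_single (X t ω)]
        · simp
        · intro x _ hx
          simp [Set.indicator, hx.symm]
        · simp
    _ = 0 := by
        rw [integral_finsetSum _ fun x _ => hi x]
        refine Finset.sum_eq_zero fun x _ => ?_
        have hXm : Measurable[P.history X A ε (t - 1) ⊔ MeasurableSpace.comap (X t) inferInstance]
            (X t) := (comap_measurable (X t)).mono le_sup_right le_rfl
        rw [integral_indicator_mul_of_condExp (sup_le (H.history_le ht) hX.comap_le)
          (H.aebdd_noise ht _) (H.env.noise_mean_zero t ht (ρ x))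
          (AEBdd.indicator_preimage hXm x)]
        simp

lemma integral_comp_context (f : 𝒳 → ℝ) : ∫ ω, f (X t ω) ∂μ = ∑ x, P.g x * f x := by
  have := P.isProbabilityMeasure_G
  rw [← integral_map (φ := X t) (H.env.measurable_X t ht).aemeasurable
    (f := f) (measurable_of_finite f).aestronglyMeasurable, H.env.law_X t ht,
    integral_fintype (.of_finite)]
  rfl

/-- The expected regret of one round. -/
lemma integral_loss_sub (ρ : 𝒳 → Fin K) :
    ∫ ω, (P.loss ε t (A t ω) (X t ω) ω - P.loss ε t (ρ (X t ω)) (X t ω) ω) ∂μ =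
      ∫ ω, ∑ x, P.g x * ∑ a, policy L lam d e q t ω x a * (P.meanLoss a x - P.meanLoss (ρ x) x) ∂μ := by
  have hA := H.env.measurable_A t ht
  have hX := H.env.measurable_X t ht
  rw [← H.integral_apply ht (F := fun a x _ => P.meanLoss a x - P.meanLoss (ρ x) x)
    fun a x => AEBdd.const _]
  have h1 := H.integral_noise_apply ht (F := fun _ _ _ => 1) fun _ _ => AEBdd.const _
  have h2 := H.integral_noise_policy ht ρ
  have hi1 : Integrable (fun ω => P.meanLoss (A t ω) (X t ω) - P.meanLoss (ρ (X t ω)) (X t ω)) μ :=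
    (AEBdd.apply (F := fun a x _ => P.meanLoss a x - P.meanLoss (ρ x) x) hA hX
      fun a x => AEBdd.const _).integrable
  have hi2 : Integrable (fun ω => ε t (A t ω) ω) μ :=
    (AEBdd.apply (F := fun a _ ω => ε t a ω) hA hX fun a x => H.aebdd_noise ht a).integrable
  have hi3 : Integrable (fun ω => ε t (ρ (X t ω)) ω) μ :=
    (AEBdd.apply (F := fun _ x ω => ε t (ρ x) ω) hA hX fun a x => H.aebdd_noise ht _).integrable
  simp only [mul_one] at h1
  calc _ = ∫ ω, ((P.meanLoss (A t ω) (X t ω) - P.meanLoss (ρ (X t ω)) (X t ω)) +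
        (ε t (A t ω) ω - ε t (ρ (X t ω)) ω)) ∂μ := by
        refine integral_congr_ae (Filter.Eventually.of_forall fun ω => ?_)
        simp only [Problem.loss, Problem.meanLoss]
        ring
    _ = _ := by
        rw [integral_add hi1 (by exact hi2.sub hi3), integral_sub hi2 hi3, h1, h2]
        simp

end IsRun

/-! ### Expected suboptimality and the averaged FTRL bound -/

section Subopt

variable {𝒳 : Type*} [Fintype 𝒳] [MeasurableSpace 𝒳] {d K : ℕ}

/-- The expected regret of `p` against the policy `ρ`, given `p`. -/
noncomputable def Problem.subopt (P : Problem 𝒳 d K) (ρ : 𝒳 → Fin K) (p : 𝒳 → Fin K → ℝ) : ℝ :=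
  ∑ x, P.g x * ∑ a, p x a * (P.meanLoss a x - P.meanLoss (ρ x) x)

/-- The probability that `p` deviates from the policy `ρ`. -/
noncomputable def Problem.deviation (P : Problem 𝒳 d K) (ρ : 𝒳 → Fin K) (p : 𝒳 → Fin K → ℝ) : ℝ :=
  ∑ x, P.g x * (1 - p x (ρ x))

end Subopt

namespace IsRun

variable {𝒳 Ω : Type*} [Fintype 𝒳] [MeasurableSpace 𝒳] [MeasurableSingletonClass 𝒳]
  [mΩ : MeasurableSpace Ω] {d K : ℕ} {P : Problem 𝒳 d K} {L lam : ℝ} {e : 𝒳 → Fin K → ℝ}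
  {μ : Measure Ω} [IsProbabilityMeasure μ]
  {T : ℕ} {q : ℕ → Ω → 𝒳 → Fin K → ℝ} {X : ℕ → Ω → 𝒳} {A : ℕ → Ω → Fin K}
  {ε : ℕ → Fin K → Ω → ℝ} (H : IsRun P L lam e μ T q X A ε) (ρ : 𝒳 → Fin K)
include H

section Round

variable {t : ℕ} (ht : t ∈ Finset.Icc 1 T)
include ht

lemma aebdd_subopt : AEBdd mΩ μ fun ω => P.subopt ρ (q t ω) :=
  AEBdd.mono (H.history_le ht) <| .sum fun x _ => (AEBdd.sum fun a _ =>
    (H.aebdd_q ht x a).mul (AEBdd.const _)).const_mul _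

lemma aebdd_subopt_policy : AEBdd mΩ μ fun ω => P.subopt ρ (policy L lam d e q t ω) :=
  AEBdd.mono (H.history_le ht) <| .sum fun x _ => (AEBdd.sum fun a _ =>
    (H.aebdd_policy ht x a).mul (AEBdd.const _)).const_mul _

lemma aebdd_one_sub (x : 𝒳) :
    AEBdd (P.history X A ε (t - 1)) μ fun ω => 1 - q t ω x (ρ x) :=
  (AEBdd.const 1).sub (H.aebdd_q ht x _)

lemma aebdd_deviation : AEBdd mΩ μ fun ω => P.deviation ρ (q t ω) :=
  AEBdd.mono (H.history_le ht) <| .sum fun x _ => (H.aebdd_one_sub ρ ht x).const_mul _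

lemma deviation_nonneg (ω : Ω) : 0 ≤ P.deviation ρ (q t ω) :=
  Finset.sum_nonneg fun x _ => mul_nonneg (P.g_nonneg x)
    (sub_nonneg.2 (H.q_le_one ht ω x (ρ x)))

lemma deviation_le_one (ω : Ω) : P.deviation ρ (q t ω) ≤ 1 := by
  rw [← P.sum_g]
  exact Finset.sum_le_sum fun x _ => mul_le_of_le_one_right (P.g_nonneg x)
    (by linarith [H.q_nonneg ht ω x (ρ x)])

/-- Jensen's inequality under the law of the contexts, in Cauchy–Schwarz form. -/
lemma sum_sqrt_le_sqrt_deviation (ω : Ω) :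
    ∑ x, P.g x * √(1 - q t ω x (ρ x)) ≤ √(P.deviation ρ (q t ω)) := by
  have hw : ∀ x, 0 ≤ 1 - q t ω x (ρ x) := fun x => by linarith [H.q_le_one ht ω x (ρ x)]
  apply Real.le_sqrt_of_sq_le
  have hcs := Finset.sum_mul_sq_le_sq_mul_sq Finset.univ
    (fun x => √(P.g x)) (fun x => √(P.g x) * √(1 - q t ω x (ρ x)))
  simp only [mul_pow, Real.sq_sqrt (P.g_nonneg _), Real.sq_sqrt (hw _), P.sum_g, one_mul,
    ← mul_assoc, Real.mul_self_sqrt (P.g_nonneg _)] at hcs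
  exact hcs

lemma subopt_policy_le (ω : Ω) :
    P.subopt ρ (policy L lam d e q t ω) ≤
      (1 - explorationRate d K L lam t) * P.subopt ρ (q t ω) + 2 * explorationRate d K L lam t := by
  have h0 := H.rate_pos (Finset.mem_Icc.1 ht).1
  have h1 : P.subopt ρ e ≤ 2 := by
    calc P.subopt ρ e ≤ ∑ x, P.g x * ∑ a, e x a * 2 := by
          refine Finset.sum_le_sum fun x _ => mul_le_mul_of_nonneg_left ?_ (P.g_nonneg x)
          refine Finset.sum_le_sum fun a _ =>
            mul_le_mul_of_nonneg_left ?_ ((H.explore.mem_simplex x).1 a)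
          linarith [(abs_le.1 (P.abs_meanLoss_le a x)).2, (abs_le.1 (P.abs_meanLoss_le (ρ x) x)).1]
      _ = 2 := by
          simp only [← Finset.sum_mul, (H.explore.mem_simplex _).2, one_mul, P.sum_g]
  have h2 : P.subopt ρ (policy L lam d e q t ω) =
      (1 - explorationRate d K L lam t) * P.subopt ρ (q t ω) +
        explorationRate d K L lam t * P.subopt ρ e := by
    simp only [Problem.subopt, policy, Finset.mul_sum, ← Finset.sum_add_distrib]
    exact Finset.sum_congr rfl fun x _ => Finset.sum_congr rfl fun a _ => by ring
  rw [h2]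
  nlinarith

lemma subopt_le_two (ω : Ω) : P.subopt ρ (q t ω) ≤ 2 := by
  calc P.subopt ρ (q t ω) ≤ ∑ x, P.g x * ∑ a, q t ω x a * 2 := by
        refine Finset.sum_le_sum fun x _ => mul_le_mul_of_nonneg_left ?_ (P.g_nonneg x)
        refine Finset.sum_le_sum fun a _ => mul_le_mul_of_nonneg_left ?_ (H.q_nonneg ht ω x a)
        linarith [(abs_le.1 (P.abs_meanLoss_le a x)).2, (abs_le.1 (P.abs_meanLoss_le (ρ x) x)).1]
    _ = 2 := by
        simp only [← Finset.sum_mul, (H.plays.mem_simplex t ht ω _).2, one_mul, P.sum_g]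

lemma integral_estimated_subopt :
    ∫ ω, ∑ x, P.g x * (∑ a, (P.estimator L lam e q X A ε t ω ⬝ᵥ P.φ a x) * q t ω x a -
      P.estimator L lam e q X A ε t ω ⬝ᵥ P.φ (ρ x) x) ∂μ = ∫ ω, P.subopt ρ (q t ω) ∂μ := by
  have hm := H.history_le ht
  have hq := fun x a => (H.aebdd_q ht x a).mono hm
  have hi1 : ∀ x a, Integrable (fun ω =>
      (P.estimator L lam e q X A ε t ω ⬝ᵥ P.φ a x) * q t ω x a) μ := fun x a =>
    ((H.aebdd_estimator ht a x).mul (hq x a)).integrable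
  have hi2 : ∀ x a, Integrable (fun ω => P.estimator L lam e q X A ε t ω ⬝ᵥ P.φ a x) μ := fun x a =>
    (H.aebdd_estimator ht a x).integrable
  have hi3 : ∀ x, Integrable (fun ω =>
      P.g x * ∑ a, q t ω x a * (P.meanLoss a x - P.meanLoss (ρ x) x)) μ := fun x =>
    ((AEBdd.sum fun a _ => (hq x a).mul (AEBdd.const _)).const_mul _).integrable
  have hi4 : ∀ x a, Integrable (fun ω => q t ω x a * P.meanLoss a x) μ := fun x a =>
    ((hq x a).mul (AEBdd.const _)).integrable
  have hi5 : ∀ x, Integrable (fun ω => P.g x *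
      (∑ a, (P.estimator L lam e q X A ε t ω ⬝ᵥ P.φ a x) * q t ω x a -
        P.estimator L lam e q X A ε t ω ⬝ᵥ P.φ (ρ x) x)) μ := fun x =>
    ((integrable_finsetSum _ fun a _ => hi1 x a).sub (hi2 x (ρ x))).const_mul _
  simp only [Problem.subopt]
  rw [integral_finsetSum _ fun x _ => hi3 x, integral_finsetSum _ fun x _ => hi5 x]
  refine Finset.sum_congr rfl fun x _ => ?_
  rw [integral_const_mul, integral_const_mul, integral_sub (integrable_finsetSum _ fun a _ => hi1 x a)
    (hi2 x (ρ x)), integral_finsetSum _ fun a _ => hi1 x a]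
  congr 1
  have h1 : ∀ a, ∫ ω, (P.estimator L lam e q X A ε t ω ⬝ᵥ P.φ a x) * q t ω x a ∂μ =
      ∫ ω, q t ω x a * P.meanLoss a x ∂μ := fun a => by
    rw [← H.integral_mul_estimator ht (H.aebdd_q ht x a) a x]
    simp only [mul_comm]
  have h2 : ∫ ω, P.estimator L lam e q X A ε t ω ⬝ᵥ P.φ (ρ x) x ∂μ = P.meanLoss (ρ x) x := by
    have := H.integral_mul_estimator ht (AEBdd.const 1) (ρ x) x
    simpa using this
  simp only [h1, h2]
  rw [← integral_finsetSum _ fun a _ => hi4 x a]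
  have h3 : ∫ _, P.meanLoss (ρ x) x ∂μ = P.meanLoss (ρ x) x := by simp
  nth_rewrite 1 [← h3]
  rw [← integral_sub (integrable_finsetSum _ fun a _ => hi4 x a) (integrable_const _)]
  refine integral_congr_ae (Filter.Eventually.of_forall fun ω => ?_)
  simp only [mul_sub, Finset.sum_sub_distrib, ← Finset.sum_mul,
    (H.plays.mem_simplex t ht ω x).2, one_mul]

/-- The weights `g √(1 - q) q` are known from the history, so the second-moment bound applies arm by
arm and `sum_sqrt_mul_invForm_le` finishes pointwise. -/
lemma integral_stability_le :
    ∫ ω, ∑ x, P.g x * (√(1 - q t ω x (ρ x)) *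
      ∑ a, q t ω x a * (P.estimator L lam e q X A ε t ω ⬝ᵥ P.φ a x) ^ 2) ∂μ ≤
      2 * (d * √L) * ∫ ω, √(P.deviation ρ (q t ω)) ∂μ := by
  have hm := H.history_le ht
  have hW : ∀ x a, AEBdd (P.history X A ε (t - 1)) μ
      fun ω => P.g x * √(1 - q t ω x (ρ x)) * q t ω x a := fun x a =>
    ((H.aebdd_one_sub ρ ht x).sqrt.const_mul _).mul (H.aebdd_q ht x a)
  have hi1 : ∀ x a, Integrable (fun ω => P.g x * √(1 - q t ω x (ρ x)) * q t ω x a *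
      (P.estimator L lam e q X A ε t ω ⬝ᵥ P.φ a x) ^ 2) μ := fun x a =>
    (((hW x a).mono hm).mul (H.aebdd_estimator ht a x).pow_two).integrable
  have hi2 : ∀ x a, Integrable (fun ω => P.g x * √(1 - q t ω x (ρ x)) * q t ω x a *
      P.invForm L lam e q t ω a x a x) μ := fun x a =>
    (((hW x a).mul (H.aebdd_invForm ht a x a x)).mono hm).integrable
  have hexp : ∀ (ω : Ω) (f : Fin K → 𝒳 → ℝ), ∑ x, P.g x * (√(1 - q t ω x (ρ x)) *
      ∑ a, q t ω x a * f a x) = ∑ x, ∑ a, P.g x * √(1 - q t ω x (ρ x)) * q t ω x a * f a x := by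
    intro ω f
    simp only [Finset.mul_sum, mul_assoc]
  calc _ = ∑ x, ∑ a, ∫ ω, P.g x * √(1 - q t ω x (ρ x)) * q t ω x a *
        (P.estimator L lam e q X A ε t ω ⬝ᵥ P.φ a x) ^ 2 ∂μ := by
        simp only [hexp _ fun a x => (P.estimator L lam e q X A ε t _ ⬝ᵥ P.φ a x) ^ 2]
        rw [integral_finsetSum _ fun x _ => integrable_finsetSum _ fun a _ => hi1 x a]
        exact Finset.sum_congr rfl fun x _ => integral_finsetSum _ fun a _ => hi1 x a
    _ ≤ ∑ x, ∑ a, ∫ ω, P.g x * √(1 - q t ω x (ρ x)) * q t ω x a *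
        P.invForm L lam e q t ω a x a x ∂μ :=
        Finset.sum_le_sum fun x _ => Finset.sum_le_sum fun a _ =>
          H.integral_mul_estimator_sq_le ht (hW x a) (fun ω => mul_nonneg (mul_nonneg
            (P.g_nonneg x) (Real.sqrt_nonneg _)) (H.q_nonneg ht ω x a)) a x
    _ = ∫ ω, ∑ x, P.g x * (√(1 - q t ω x (ρ x)) *
          ∑ a, q t ω x a * P.invForm L lam e q t ω a x a x) ∂μ := by
        simp only [hexp _ fun a x => P.invForm L lam e q t _ a x a x]
        rw [integral_finsetSum _ fun x _ => integrable_finsetSum _ fun a _ => hi2 x a]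
        exact Finset.sum_congr rfl fun x _ => (integral_finsetSum _ fun a _ => hi2 x a).symm
    _ ≤ ∫ ω, 2 * (d * √L) * √(P.deviation ρ (q t ω)) ∂μ := by
        refine integral_mono ?_ ((H.aebdd_deviation ρ ht).sqrt.const_mul _).integrable
          fun ω => H.sum_sqrt_mul_invForm_le ht ω ρ
        simp only [hexp _ fun a x => P.invForm L lam e q t _ a x a x]
        exact integrable_finsetSum _ fun x _ => integrable_finsetSum _ fun a _ => hi2 x a
    _ = _ := integral_const_mul _ _

omit ht in
-- Round `1` has no regularizer to control the move from `q_1` to `q_2`. It is bounded crudely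
-- through `|l| ≤ c / 2 + l² / (2c)` and the second moment of the estimator.
lemma integral_first_round_le (hT : 2 ≤ T) :
    ∫ ω, ∑ x, P.g x * ∑ a, (P.estimator L lam e q X A ε 1 ω ⬝ᵥ P.φ a x) *
      (q 1 ω x a - q 2 ω x a) ∂μ ≤ 4 * √(K * L / lam) := by
  have h1T : 1 ∈ Finset.Icc 1 T := Finset.mem_Icc.2 (by omega)
  have h2T : 2 ∈ Finset.Icc 1 T := Finset.mem_Icc.2 (by omega)
  have hK : (1 : ℝ) ≤ K := by exact_mod_cast H.one_le_K
  have hL := H.one_le_L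
  have hl := H.lam_pos
  -- This balances `c` against the sum over `K` arms of second moments of order `1 / lam`, divided
  -- by `c`.
  set c := √(K / lam) with hc
  have hc0 : 0 < c := Real.sqrt_pos.2 (by positivity)
  have hq1 := fun x a => (H.aebdd_q h1T x a).mono (H.history_le h1T)
  have hq2 := fun x a => (H.aebdd_q h2T x a).mono (H.history_le h2T)
  have hest := fun x a => H.aebdd_estimator h1T a x
  have hsq : ∀ x a, ∫ ω, (P.estimator L lam e q X A ε 1 ω ⬝ᵥ P.φ a x) ^ 2 ∂μ ≤ 3 / lam := by
    intro x a
    have h1 := H.integral_mul_estimator_sq_le h1T (AEBdd.const 1) (fun _ => zero_le_one) a x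
    simp only [one_mul] at h1
    refine h1.trans ?_
    have h2 : ∀ ω, P.invForm L lam e q 1 ω a x a x ≤ 3 / lam := by
      intro ω
      refine (H.invForm_self_le h1T ω a x).trans ?_
      have h3 := invLearningRate_one_le H.one_le_d H.one_le_K hL hl H.natCast_d_le
      have h4 := (invLearningRate_pos H.one_le_d H.one_le_K hL hl (t := 1) le_rfl).le
      calc _ ≤ (17 * √(L / lam)) ^ 2 / (128 * L) := by gcongr
        _ = 289 / 128 / lam := by
            rw [mul_pow, Real.sq_sqrt (by positivity)]
            field_simp
            norm_num
        _ ≤ 3 / lam := by gcongr; norm_num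
    calc _ ≤ ∫ _, 3 / lam ∂μ := integral_mono
          ((H.aebdd_invForm h1T a x a x).mono (H.history_le h1T)).integrable
          (integrable_const _) h2
      _ = _ := by simp
  have hpt : ∀ ω, ∑ x, P.g x * ∑ a, (P.estimator L lam e q X A ε 1 ω ⬝ᵥ P.φ a x) *
      (q 1 ω x a - q 2 ω x a) ≤
      c + ∑ x, P.g x * ∑ a, 1 / c * (P.estimator L lam e q X A ε 1 ω ⬝ᵥ P.φ a x) ^ 2 := by
    intro ω
    have h1 : c = ∑ x, P.g x * ∑ a, c / 2 * (q 1 ω x a + q 2 ω x a) := by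
      simp only [← Finset.mul_sum, Finset.sum_add_distrib, (H.plays.mem_simplex 1 h1T ω _).2,
        (H.plays.mem_simplex 2 h2T ω _).2, ← Finset.sum_mul, P.sum_g]
      ring
    nth_rewrite 1 [h1]
    rw [← Finset.sum_add_distrib]
    refine Finset.sum_le_sum fun x _ => ?_
    rw [← mul_add, ← Finset.sum_add_distrib]
    refine mul_le_mul_of_nonneg_left (Finset.sum_le_sum fun a _ => ?_) (P.g_nonneg x)
    set l := P.estimator L lam e q X A ε 1 ω ⬝ᵥ P.φ a x
    have a1 := H.q_nonneg h1T ω x a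
    have a2 := H.q_nonneg h2T ω x a
    have a3 := H.q_le_one h1T ω x a
    have a4 := H.q_le_one h2T ω x a
    have a5 : |l| ≤ c / 2 + 1 / c * l ^ 2 / 2 := by
      have : c / 2 + 1 / c * l ^ 2 / 2 - |l| = (c - |l|) ^ 2 / (2 * c) := by
        rw [← sq_abs l]
        field_simp
        ring
      have : 0 ≤ (c - |l|) ^ 2 / (2 * c) := by positivity
      linarith
    have a6 : 0 ≤ 1 / c * l ^ 2 / 2 := by positivity
    calc l * (q 1 ω x a - q 2 ω x a) ≤ |l| * (q 1 ω x a + q 2 ω x a) := by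
          nlinarith [le_abs_self l, neg_abs_le l]
      _ ≤ (c / 2 + 1 / c * l ^ 2 / 2) * (q 1 ω x a + q 2 ω x a) := by gcongr
      _ ≤ _ := by nlinarith
  have hi : ∀ x a, Integrable (fun ω =>
      1 / c * (P.estimator L lam e q X A ε 1 ω ⬝ᵥ P.φ a x) ^ 2) μ := fun x a =>
    ((hest x a).pow_two.const_mul _).integrable
  have hi' : ∀ x, Integrable (fun ω => P.g x *
      ∑ a, 1 / c * (P.estimator L lam e q X A ε 1 ω ⬝ᵥ P.φ a x) ^ 2) μ := fun x =>
    (integrable_finsetSum _ fun a _ => hi x a).const_mul _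
  have hcK : c ≤ √(K * L / lam) := by
    apply Real.sqrt_le_sqrt
    gcongr
    nlinarith
  calc _ ≤ ∫ ω, (c + ∑ x, P.g x * ∑ a,
        1 / c * (P.estimator L lam e q X A ε 1 ω ⬝ᵥ P.φ a x) ^ 2) ∂μ := by
        refine integral_mono ?_ ((integrable_const _).add (integrable_finsetSum _ fun x _ => hi' x)) hpt
        exact (AEBdd.sum fun x _ => (AEBdd.sum fun a _ =>
          (hest x a).mul ((hq1 x a).sub (hq2 x a))).const_mul _).integrable
    _ = c + ∑ x, P.g x * ∑ a, 1 / c *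
        ∫ ω, (P.estimator L lam e q X A ε 1 ω ⬝ᵥ P.φ a x) ^ 2 ∂μ := by
        rw [integral_add (integrable_const _) (integrable_finsetSum _ fun x _ => hi' x),
          integral_finsetSum _ fun x _ => hi' x]
        congr 1
        · simp
        · refine Finset.sum_congr rfl fun x _ => ?_
          rw [integral_const_mul, integral_finsetSum _ fun a _ => hi x a]
          simp only [integral_const_mul]
    _ ≤ c + ∑ x, P.g x * ∑ _a : Fin K, 1 / c * (3 / lam) := by
        gcongr with x _ a _
        · exact P.g_nonneg x
        · exact hsq x a
    _ = c + 3 * (K / lam) / c := by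
        rw [← Finset.sum_mul, P.sum_g]
        simp
        field_simp
    _ = 4 * c := by
        rw [← Real.sq_sqrt (show 0 ≤ (K : ℝ) / lam by positivity), ← hc]
        field_simp
        norm_num
    _ ≤ _ := by gcongr

end Round

/-- Only almost sure, because the losses are bounded almost surely. The bound uses the minimizer
`q_{n+1}`, hence `n + 1 ≤ T`. -/
lemma ae_ftrl_bound {n : ℕ} (hn : 1 ≤ n) (hnT : n + 1 ≤ T) : ∀ᵐ ω ∂μ, ∀ x,
    ∑ t ∈ Finset.Icc 1 n, (∑ a, (P.estimator L lam e q X A ε t ω ⬝ᵥ P.φ a x) * q t ω x a -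
      P.estimator L lam e q X A ε t ω ⬝ᵥ P.φ (ρ x) x) ≤
    ∑ a, (P.estimator L lam e q X A ε 1 ω ⬝ᵥ P.φ a x) * (q 1 ω x a - q 2 ω x a) +
    ∑ t ∈ Finset.Icc 2 n, 4 / invLearningRate d K L lam (t - 1) * (√(1 - q t ω x (ρ x)) *
      ∑ a, q t ω x a * (P.estimator L lam e q X A ε t ω ⬝ᵥ P.φ a x) ^ 2) +
    ∑ t ∈ Finset.Icc 1 n, (invLearningRate d K L lam t - invLearningRate d K L lam (t - 1)) *
      (2 * (√K * √(1 - q (t + 1) ω x (ρ x)))) := by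
  have hd := H.one_le_d
  have hK := H.one_le_K
  have hL := H.one_le_L
  have hl := H.lam_pos
  have hall : ∀ᵐ ω ∂μ, ∀ t ∈ Finset.Icc 1 T, |P.loss ε t (A t ω) (X t ω) ω| ≤ 1 :=
    (Filter.eventually_all_finset _).2 fun t ht => H.abs_loss_apply_le ht
  have hsub : ∀ t ∈ Finset.Icc 1 (n + 1), t ∈ Finset.Icc 1 T := fun t ht => by
    rw [Finset.mem_Icc] at *
    omega
  filter_upwards [hall] with ω hω x
  refine ftrl_bound (fun t a => P.estimator L lam e q X A ε t ω ⬝ᵥ P.φ a x)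
    (invLearningRate d K L lam) invLearningRate_zero
    (fun t ht => invLearningRate_pos hd hK hL hl ht)
    (fun t ht => invLearningRate_pred_le hd hK hL hl ht) (fun t => q t ω x) n hn
    (fun t ht => H.plays.mem_simplex t (hsub t ht) ω x)
    (fun t ht => H.plays.isMinOn t (hsub t ht) ω x) (fun t ht a => ?_) (ρ x)
  have ht' : t ∈ Finset.Icc 1 T := by
    rw [Finset.mem_Icc] at *
    omega
  have h1 := H.sqrt_q_mul_abs_invForm_le ht' ω a x (A t ω) (X t ω)
  -- The estimate in terms of `r_t / 8` becomes the required `r_{t-1} / 4` because `1 / η` at most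
  -- doubles per round.
  have h2 := invLearningRate_le_pred hd hK hL hl (Finset.mem_Icc.1 ht).1
  simp only [H.estimator_dotProduct]
  rw [abs_mul]
  calc √(q t ω x a) * (|P.loss ε t (A t ω) (X t ω) ω| * |P.invForm L lam e q t ω a x (A t ω) (X t ω)|)
      ≤ √(q t ω x a) * (1 * |P.invForm L lam e q t ω a x (A t ω) (X t ω)|) := by
        gcongr
        exact hω t ht'
    _ ≤ _ := by rw [one_mul]; linarith

/-- Expectation of the FTRL bound averaged over contexts. The constant `38` is `4` from the first
round plus `34` from the first penalty; `20` is `16` from stability plus `4` from the later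
penalties. -/
lemma sum_integral_subopt_le {n : ℕ} (hn : 1 ≤ n) (hnT : n + 1 ≤ T) :
    ∑ t ∈ Finset.Icc 1 n, ∫ ω, P.subopt ρ (q t ω) ∂μ ≤ 38 * √(K * L / lam) +
      ∑ t ∈ Finset.Icc 2 (n + 1), 20 * (√d * (K : ℝ) ^ (1 / 4 : ℝ) * √L) / √t *
        ∫ ω, √(P.deviation ρ (q t ω)) ∂μ := by
  have hd := H.one_le_d
  have hK := H.one_le_K
  have hL := H.one_le_L
  have hl := H.lam_pos
  have hk := one_le_rpow_quarter hK
  have hk2 := rpow_quarter_sq K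
  set k := (K : ℝ) ^ (1 / 4 : ℝ) with hkdef
  set r := invLearningRate d K L lam with hr
  set U : ℕ → ℝ := fun t => ∫ ω, √(P.deviation ρ (q t ω)) ∂μ with hU
  have hU0 : ∀ t, 0 ≤ U t := fun t => integral_nonneg fun ω => Real.sqrt_nonneg _
  have hmem : ∀ t, 1 ≤ t → t ≤ n + 1 → t ∈ Finset.Icc 1 T := fun t h1 h2 =>
    Finset.mem_Icc.2 ⟨h1, by omega⟩
  have hq := fun t (ht : t ∈ Finset.Icc 1 T) x a => (H.aebdd_q ht x a).mono (H.history_le ht)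
  have hw := fun t (ht : t ∈ Finset.Icc 1 T) x => (H.aebdd_one_sub ρ ht x).mono (H.history_le ht)
  -- the parts of the FTRL bound, averaged over the contexts
  set f0 : ℕ → Ω → ℝ := fun t ω => ∑ x, P.g x *
    (∑ a, (P.estimator L lam e q X A ε t ω ⬝ᵥ P.φ a x) * q t ω x a -
      P.estimator L lam e q X A ε t ω ⬝ᵥ P.φ (ρ x) x) with hf0
  set f1 : Ω → ℝ := fun ω => ∑ x, P.g x *
    ∑ a, (P.estimator L lam e q X A ε 1 ω ⬝ᵥ P.φ a x) * (q 1 ω x a - q 2 ω x a) with hf1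
  set f2 : ℕ → Ω → ℝ := fun t ω => ∑ x, P.g x * (√(1 - q t ω x (ρ x)) *
      ∑ a, q t ω x a * (P.estimator L lam e q X A ε t ω ⬝ᵥ P.φ a x) ^ 2) with hf2
  set f3 : ℕ → Ω → ℝ := fun t ω => ∑ x, P.g x * √(1 - q t ω x (ρ x)) with hf3
  have b0 : ∀ t ∈ Finset.Icc 1 n, AEBdd mΩ μ (f0 t) := fun t ht => by
    have ht' := hmem t (Finset.mem_Icc.1 ht).1 (by have := (Finset.mem_Icc.1 ht).2; omega)
    exact .sum fun x _ => ((AEBdd.sum fun a _ => (H.aebdd_estimator ht' a x).mul (hq t ht' x a)).sub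
      (H.aebdd_estimator ht' _ x)).const_mul _
  have b1 : AEBdd mΩ μ f1 := .sum fun x _ => (AEBdd.sum fun a _ =>
    (H.aebdd_estimator (hmem 1 le_rfl (by omega)) a x).mul
      ((hq 1 (hmem 1 le_rfl (by omega)) x a).sub (hq 2 (hmem 2 (by omega) (by omega)) x a))).const_mul _
  have b2 : ∀ t ∈ Finset.Icc 2 n, AEBdd mΩ μ (f2 t) := fun t ht => by
    have ht' := hmem t (by have := (Finset.mem_Icc.1 ht).1; omega)
      (by have := (Finset.mem_Icc.1 ht).2; omega)
    exact .sum fun x _ => ((hw t ht' x).sqrt.mul (AEBdd.sum fun a _ =>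
      (hq t ht' x a).mul (H.aebdd_estimator ht' a x).pow_two)).const_mul _
  have b3 : ∀ t ∈ Finset.Icc 1 n, AEBdd mΩ μ (f3 (t + 1)) := fun t ht => by
    have ht' := hmem (t + 1) (by omega) (by have := (Finset.mem_Icc.1 ht).2; omega)
    exact .sum fun x _ => (hw _ ht' x).sqrt.const_mul _
  have hae : ∀ᵐ ω ∂μ, ∑ t ∈ Finset.Icc 1 n, f0 t ω ≤ f1 ω +
      ∑ t ∈ Finset.Icc 2 n, 4 / r (t - 1) * f2 t ω +
      ∑ t ∈ Finset.Icc 1 n, (r t - r (t - 1)) * (2 * √K) * f3 (t + 1) ω := by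
    filter_upwards [H.ae_ftrl_bound ρ hn hnT] with ω hω
    have h1 := Finset.sum_le_sum fun x (_ : x ∈ Finset.univ) =>
      mul_le_mul_of_nonneg_left (hω x) (P.g_nonneg x)
    have e0 : ∑ t ∈ Finset.Icc 1 n, f0 t ω = ∑ x, P.g x * ∑ t ∈ Finset.Icc 1 n,
        (∑ a, (P.estimator L lam e q X A ε t ω ⬝ᵥ P.φ a x) * q t ω x a -
          P.estimator L lam e q X A ε t ω ⬝ᵥ P.φ (ρ x) x) := by
      simp only [hf0]
      rw [Finset.sum_comm]
      simp only [Finset.mul_sum]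
    have swap : ∀ (s : Finset ℕ) (c : ℕ → ℝ) (F : ℕ → 𝒳 → ℝ),
        ∑ t ∈ s, c t * ∑ x, P.g x * F t x = ∑ x, P.g x * ∑ t ∈ s, c t * F t x := by
      intro s c F
      simp only [Finset.mul_sum]
      rw [Finset.sum_comm]
      exact Finset.sum_congr rfl fun x _ => Finset.sum_congr rfl fun t _ => by ring
    have e2 : ∑ t ∈ Finset.Icc 2 n, 4 / r (t - 1) * f2 t ω = ∑ x, P.g x *
        ∑ t ∈ Finset.Icc 2 n, 4 / r (t - 1) * (√(1 - q t ω x (ρ x)) *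
          ∑ a, q t ω x a * (P.estimator L lam e q X A ε t ω ⬝ᵥ P.φ a x) ^ 2) := by
      exact swap _ (fun t => 4 / r (t - 1)) _
    have e3 : ∑ t ∈ Finset.Icc 1 n, (r t - r (t - 1)) * (2 * √K) * f3 (t + 1) ω = ∑ x, P.g x *
        ∑ t ∈ Finset.Icc 1 n, (r t - r (t - 1)) * (2 * (√K * √(1 - q (t + 1) ω x (ρ x)))) := by
      rw [swap _ (fun t => (r t - r (t - 1)) * (2 * √K)) fun t x => √(1 - q (t + 1) ω x (ρ x))]
      simp only [mul_assoc]
    rw [e0, e2, e3, hf1]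
    simpa only [mul_add, Finset.sum_add_distrib] using h1
  have i2 : Integrable (fun ω => ∑ t ∈ Finset.Icc 2 n, 4 / r (t - 1) * f2 t ω) μ :=
    (AEBdd.sum fun t ht => (b2 t ht).const_mul _).integrable
  have i3 : Integrable (fun ω => ∑ t ∈ Finset.Icc 1 n,
      (r t - r (t - 1)) * (2 * √K) * f3 (t + 1) ω) μ :=
    (AEBdd.sum fun t ht => (b3 t ht).const_mul _).integrable
  have hint := integral_mono_ae (AEBdd.sum b0).integrable (by exact (b1.integrable.add i2).add i3) hae
  rw [integral_add (by exact b1.integrable.add i2) i3, integral_add b1.integrable i2,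
    integral_finsetSum _ fun t ht => (b0 t ht).integrable,
    integral_finsetSum _ fun t ht => ((b2 t ht).const_mul _).integrable,
    integral_finsetSum _ fun t ht => ((b3 t ht).const_mul _).integrable] at hint
  simp only [integral_const_mul] at hint
  have hlhs : ∑ t ∈ Finset.Icc 1 n, ∫ ω, f0 t ω ∂μ =
      ∑ t ∈ Finset.Icc 1 n, ∫ ω, P.subopt ρ (q t ω) ∂μ :=
    Finset.sum_congr rfl fun t ht => H.integral_estimated_subopt ρ
      (hmem t (Finset.mem_Icc.1 ht).1 (by have := (Finset.mem_Icc.1 ht).2; omega))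
  rw [hlhs] at hint
  have hd0 : 0 < √(d : ℝ) := Real.sqrt_pos.2 (by exact_mod_cast hd)
  have hdd : √(d : ℝ) ^ 2 = d := Real.sq_sqrt (Nat.cast_nonneg d)
  have hk0 : 0 < k := by linarith
  have hL1 : 1 ≤ √L := Real.one_le_sqrt.2 hL
  have c1 : ∫ ω, f1 ω ∂μ ≤ 4 * √(K * L / lam) := H.integral_first_round_le (by omega)
  have c2 : ∑ t ∈ Finset.Icc 2 n, 4 / r (t - 1) * ∫ ω, f2 t ω ∂μ ≤
      ∑ t ∈ Finset.Icc 2 n, 16 * (√d * k * √L) / √t * U t := by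
    refine Finset.sum_le_sum fun t ht => ?_
    have ht2 := (Finset.mem_Icc.1 ht).1
    have ht' := hmem t (by omega) (by have := (Finset.mem_Icc.1 ht).2; omega)
    have h1 := H.integral_stability_le ρ ht'
    have h2 := one_div_invLearningRate_pred_le hd hK hL hl ht2
    have h3 := invLearningRate_pos hd hK hL hl (t := t - 1) (by omega)
    calc 4 / r (t - 1) * ∫ ω, f2 t ω ∂μ ≤ 4 / r (t - 1) * (2 * (d * √L) * U t) := by
          gcongr
      _ = 8 * (d * √L) * U t * (1 / r (t - 1)) := by ring
      _ ≤ 8 * (d * √L) * U t * (2 * (k / √d) / √t) := by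
          have := hU0 t
          gcongr
      _ = _ := by
          nth_rewrite 1 [← hdd]
          field_simp
          ring
  have c3 : ∀ t ∈ Finset.Icc 1 n, ∫ ω, f3 (t + 1) ω ∂μ ≤ U (t + 1) := fun t ht => by
    have ht' := hmem (t + 1) (by omega) (by have := (Finset.mem_Icc.1 ht).2; omega)
    exact integral_mono (b3 t ht).integrable (H.aebdd_deviation ρ ht').sqrt.integrable
      fun ω => H.sum_sqrt_le_sqrt_deviation ρ ht' ω
  have hIoc : Finset.Ioc 1 n = Finset.Icc 2 n := by
    ext t
    simp only [Finset.mem_Ioc, Finset.mem_Icc]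
    omega
  have c4 : ∑ t ∈ Finset.Icc 1 n, (r t - r (t - 1)) * (2 * √K) * ∫ ω, f3 (t + 1) ω ∂μ ≤
      34 * √(K * L / lam) +
        ∑ t ∈ Finset.Icc 2 n, 4 * (√d * k * √L) / √((t + 1 : ℕ) : ℝ) * U (t + 1) := by
    -- The first increment is all of `1 / η_1`, since `1 / η_0 = 0`; it is not small and goes into
    -- the constant term.
    rw [← Finset.add_sum_Ioc_eq_sum_Icc hn, hIoc]
    refine add_le_add ?_ (Finset.sum_le_sum fun t ht => ?_)
    · have h1 : U 2 ≤ 1 := by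
        have ht' := hmem 2 (by omega) (by omega)
        calc U 2 ≤ ∫ _, (1 : ℝ) ∂μ := integral_mono (H.aebdd_deviation ρ ht').sqrt.integrable
              (integrable_const _) fun ω => Real.sqrt_le_one.2 (H.deviation_le_one ρ ht' ω)
          _ = 1 := by simp
      have h2 := c3 1 (Finset.mem_Icc.2 (by omega))
      have h3 := invLearningRate_one_le hd hK hL hl H.natCast_d_le
      have h4 := (invLearningRate_pos hd hK hL hl (t := 1) le_rfl).le
      have h5 : r (1 - 1) = 0 := invLearningRate_zero
      rw [h5, sub_zero]
      calc r 1 * (2 * √K) * ∫ ω, f3 (1 + 1) ω ∂μ ≤ r 1 * (2 * √K) * 1 :=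
            mul_le_mul_of_nonneg_left (h2.trans h1) (by positivity)
        _ ≤ 17 * √(L / lam) * (2 * √K) * 1 := by gcongr
        _ = 34 * √(K * L / lam) := by
            rw [mul_div_assoc, Real.sqrt_mul (Nat.cast_nonneg K)]
            ring
    · have ht2 := (Finset.mem_Icc.1 ht).1
      have h1 := invLearningRate_sub_le hd hK hL hl ht2
      have h2 := c3 t (Finset.mem_Icc.2 ⟨by omega, (Finset.mem_Icc.1 ht).2⟩)
      have h3 := sub_nonneg.2 (invLearningRate_pred_le hd hK hL hl (t := t) (by omega))
      have h4 := hU0 (t + 1)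
      have ht0 : 0 < √((t + 1 : ℕ) : ℝ) := Real.sqrt_pos.2 (by positivity)
      calc _ ≤ (r t - r (t - 1)) * (2 * √K) * U (t + 1) := by gcongr
        _ ≤ 2 * (√d / k) / √((t + 1 : ℕ) : ℝ) * (2 * √K) * U (t + 1) := by gcongr
        _ = 4 * (√d * k * 1) / √((t + 1 : ℕ) : ℝ) * U (t + 1) := by
            rw [← hk2]
            field_simp
            ring
        _ ≤ _ := by gcongr
  have c5 : ∑ t ∈ Finset.Icc 2 n, 4 * (√d * k * √L) / √((t + 1 : ℕ) : ℝ) * U (t + 1) ≤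
      ∑ t ∈ Finset.Icc 2 (n + 1), 4 * (√d * k * √L) / √(t : ℝ) * U t := by
    rw [← Finset.sum_image (f := fun t : ℕ => 4 * (√d * k * √L) / √(t : ℝ) * U t)
      (g := fun t => t + 1) (fun a _ b _ h => by simpa using h)]
    refine Finset.sum_le_sum_of_subset_of_nonneg (fun t ht => ?_) fun t _ _ => ?_
    · simp only [Finset.mem_image, Finset.mem_Icc] at ht ⊢
      omega
    · have := hU0 t
      positivity
  have c6 : ∑ t ∈ Finset.Icc 2 n, 16 * (√d * k * √L) / √t * U t ≤
      ∑ t ∈ Finset.Icc 2 (n + 1), 16 * (√d * k * √L) / √t * U t := by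
    refine Finset.sum_le_sum_of_subset_of_nonneg (Finset.Icc_subset_Icc_right (by omega))
      fun t _ _ => ?_
    have := hU0 t
    positivity
  have c7 : ∑ t ∈ Finset.Icc 2 (n + 1), 20 * (√d * k * √L) / √t * U t =
      ∑ t ∈ Finset.Icc 2 (n + 1), 16 * (√d * k * √L) / √t * U t +
      ∑ t ∈ Finset.Icc 2 (n + 1), 4 * (√d * k * √L) / √t * U t := by
    rw [← Finset.sum_add_distrib]
    exact Finset.sum_congr rfl fun t _ => by ring
  rw [c7]
  linarith

end IsRun

/-! ### Balancing the self-bounding inequality -/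

lemma sum_one_div_le_one_add_log (T : ℕ) :
    ∑ t ∈ Finset.Icc 1 T, 1 / (t : ℝ) ≤ 1 + Real.log T := by
  have h := harmonic_le_one_add_log T
  rw [harmonic_eq_sum_Icc] at h
  push_cast at h
  simpa only [one_div] using h

/-- The choice of the threshold on the gap that balances the two sides of the self-bounding
inequality. -/
lemma selfBounding_le {R Q T D κ Δ b : ℝ} (hT : 0 < T) (hD : 0 < D) (hκ : 0 ≤ κ) (hΔ : 0 < Δ)
    (hb : 0 < b) (hQ : Q ≤ T) (hupper : ∀ h, 0 < h → R ≤ 768 * κ + h / 8 * Q + 800 * (D / h))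
    (hlower : ∀ h, 0 < h → h ≤ Δ → h / 2 * (Q - T * (1 / 2 * (h / Δ) ^ b)) ≤ R) :
    R ≤ 1100 * (((1 + b) / (b * Δ)) ^ (b / (2 + b)) * D ^ ((1 + b) / (2 + b)) *
      T ^ (1 / (2 + b)) + κ) := by
  -- The solution of `T h² (h / Δ)^b = D`, which equates `D / h` with the margin term `h T (h /
  -- Δ)^b`.
  set h := (D * Δ ^ b / T) ^ (1 / (2 + b)) with hh
  have h2b : 0 < 2 + b := by linarith
  have hh0 : 0 < h := by positivity
  have hpow : h ^ (2 + b) = D * Δ ^ b / T := by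
    rw [hh, ← Real.rpow_mul (by positivity), one_div_mul_cancel h2b.ne', Real.rpow_one]
  have hkey : T * (h ^ 2 * (h / Δ) ^ b) = D := by
    rw [Real.div_rpow hh0.le hΔ.le]
    have : h ^ (2 + b) = h ^ 2 * h ^ b := by
      rw [Real.rpow_add hh0]
      norm_num
    rw [mul_div_assoc', ← this, hpow]
    have := Real.rpow_pos_of_pos hΔ b
    field_simp
  have hDh : D / h ≤ ((1 + b) / (b * Δ)) ^ (b / (2 + b)) * D ^ ((1 + b) / (2 + b)) *
      T ^ (1 / (2 + b)) := by
    have e1 : D / h = (1 / Δ) ^ (b / (2 + b)) * D ^ ((1 + b) / (2 + b)) * T ^ (1 / (2 + b)) := by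
      rw [div_eq_iff hh0.ne', hh, Real.div_rpow (by positivity) hT.le,
        Real.mul_rpow hD.le (by positivity), ← Real.rpow_mul hΔ.le, Real.div_rpow zero_le_one hΔ.le,
        Real.one_rpow, show b * (1 / (2 + b)) = b / (2 + b) by ring]
      have e2 : D = D ^ ((1 + b) / (2 + b)) * D ^ (1 / (2 + b)) := by
        rw [← Real.rpow_add hD, ← add_div, show 1 + b + 1 = 2 + b by ring, div_self h2b.ne',
          Real.rpow_one]
      have := Real.rpow_pos_of_pos hΔ (b / (2 + b))
      have := Real.rpow_pos_of_pos hT (1 / (2 + b))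
      nth_rewrite 1 [e2]
      field_simp
    rw [e1]
    -- The balance yields `1 / Δ`; the factor `(1 + b) / b ≥ 1` only weakens the bound.
    gcongr ?_ ^ _ * _ * _
    rw [div_le_div_iff₀ hΔ (by positivity)]
    nlinarith
  have hV : R ≤ 1100 * (D / h + κ) := by
    have hup := hupper h hh0
    have hDh0 : 0 < D / h := by positivity
    -- For `h ≤ Δ` the lower bound turns `(h / 8) Q` into `R / 4` plus a multiple of `D / h`. For `h
    -- ≥ Δ` the margin condition is silent, but `Q ≤ T` and `(h / Δ)^b ≥ 1` give `h Q ≤ D / h`.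
    rcases le_total h Δ with hle | hle
    · have hlow := hlower h hh0 hle
      have e3 : h * (T * (h / Δ) ^ b) = D / h := by
        rw [eq_div_iff hh0.ne', ← hkey]
        ring
      have e4 : h * Q ≤ 2 * R + 1 / 2 * (D / h) := by
        rw [← e3]
        linarith
      linarith
    · have e3 : h * T ≤ D / h := by
        rw [le_div_iff₀ hh0]
        have : 1 ≤ (h / Δ) ^ b := Real.one_le_rpow ((one_le_div hΔ).2 hle) hb.le
        calc h * T * h = T * (h ^ 2 * 1) := by ring
          _ ≤ T * (h ^ 2 * (h / Δ) ^ b) := by gcongr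
          _ = D := hkey
      have e4 : h * Q ≤ h * T := by gcongr
      linarith
  exact hV.trans (by gcongr)

/-! ### Upper and lower bounds on the regret -/

namespace IsRun

variable {𝒳 Ω : Type*} [Fintype 𝒳] [MeasurableSpace 𝒳] [MeasurableSingletonClass 𝒳]
  [mΩ : MeasurableSpace Ω] {d K : ℕ} {P : Problem 𝒳 d K} {L lam : ℝ} {e : 𝒳 → Fin K → ℝ}
  {μ : Measure Ω} [IsProbabilityMeasure μ]
  {T : ℕ} {q : ℕ → Ω → 𝒳 → Fin K → ℝ} {X : ℕ → Ω → 𝒳} {A : ℕ → Ω → Fin K}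
  {ε : ℕ → Fin K → Ω → ℝ} (H : IsRun P L lam e μ T q X A ε) {ρ : 𝒳 → Fin K}
include H

/-- An optimal policy is optimal in every context. -/
lemma meanLoss_le_of_isOptimalPolicy (hT : 1 ≤ T) (hρ : P.IsOptimalPolicy μ T X ρ) (a : Fin K)
    (x : 𝒳) : P.meanLoss (ρ x) x ≤ P.meanLoss a x := by
  classical
  have hsum : ∀ ρ' : 𝒳 → Fin K,
      ∫ ω, ∑ t ∈ Finset.Icc 1 T, P.φ (ρ' (X t ω)) (X t ω) ⬝ᵥ P.θ₀ ∂μ =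
        T * ∑ x, P.g x * P.meanLoss (ρ' x) x := by
    intro ρ'
    rw [integral_finsetSum _ fun t ht => ?_]
    · refine (Finset.sum_congr rfl fun t ht =>
        H.integral_comp_context ht fun x => P.meanLoss (ρ' x) x).trans ?_
      simp
    · refine Integrable.of_bound (C := 1) ?_ (Filter.Eventually.of_forall fun ω => ?_)
      · exact ((measurable_of_finite fun x => P.φ (ρ' x) x ⬝ᵥ P.θ₀).comp
          (H.env.measurable_X t ht)).aestronglyMeasurable
      · exact P.abs_meanLoss_le _ _
  -- Changing the policy in one context, which has positive mass, isolates that context.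
  have h1 := hρ (Function.update ρ x a)
  rw [hsum, hsum] at h1
  have hT0 : (0 : ℝ) < T := by exact_mod_cast hT
  have h2 := le_of_mul_le_mul_left h1 hT0
  rw [← Finset.add_sum_erase _ _ (Finset.mem_univ x),
    ← Finset.add_sum_erase _ (fun y => P.g y * P.meanLoss (Function.update ρ x a y) y)
      (Finset.mem_univ x)] at h2
  have h3 : ∑ y ∈ Finset.univ.erase x, P.g y * P.meanLoss (Function.update ρ x a y) y =
      ∑ y ∈ Finset.univ.erase x, P.g y * P.meanLoss (ρ y) y :=
    Finset.sum_congr rfl fun y hy => by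
      rw [Function.update_of_ne (Finset.ne_of_mem_erase hy)]
  rw [h3] at h2
  simp only [Function.update_self] at h2
  exact le_of_mul_le_mul_left (by linarith) (H.g_pos x)

variable (hρ : ∀ a x, P.meanLoss (ρ x) x ≤ P.meanLoss a x)

include hρ in
-- No competitor does better than `ρ` in any context, so one bound serves the whole supremum.
lemma regret_le :
    P.regret μ T X A ε ≤
      ∑ t ∈ Finset.Icc 1 T, ∫ ω, P.subopt ρ (policy L lam d e q t ω) ∂μ := by
  have : Nonempty (𝒳 → Fin K) := ⟨ρ⟩
  refine ciSup_le fun ρ' => ?_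
  rw [integral_finsetSum _ fun t ht => ?_]
  · refine Finset.sum_le_sum fun t ht => ?_
    rw [H.integral_loss_sub ht ρ']
    refine integral_mono (H.aebdd_subopt_policy ρ' ht).integrable
      (H.aebdd_subopt_policy ρ ht).integrable fun ω => ?_
    refine Finset.sum_le_sum fun x _ => mul_le_mul_of_nonneg_left ?_ (P.g_nonneg x)
    refine Finset.sum_le_sum fun a _ => mul_le_mul_of_nonneg_left ?_ (H.policy_nonneg ht ω x a)
    linarith [hρ (ρ' x) x]
  · exact (AEBdd.apply (F := fun a x ω => P.loss ε t a x ω - P.loss ε t (ρ' x) x ω)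
      (H.env.measurable_A t ht) (H.env.measurable_X t ht)
      fun a x => (H.aebdd_loss ht a x).sub (H.aebdd_loss ht _ x)).integrable

/-- The self-bounding lower bound on the regret: outside of `B` all gaps are at least `h`. -/
lemma lower_bound {h : ℝ} (hh : 0 ≤ h) (hρ : ∀ a x, P.meanLoss (ρ x) x ≤ P.meanLoss a x)
    (B : Set 𝒳) (hB : ∀ x ∉ B, ∀ a, a ≠ ρ x → h ≤ P.meanLoss a x - P.meanLoss (ρ x) x) :
    h / 2 * (∑ t ∈ Finset.Icc 1 T, ∫ ω, P.deviation ρ (q t ω) ∂μ - T * P.G.real B) ≤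
      ∑ t ∈ Finset.Icc 1 T, ∫ ω, P.subopt ρ (policy L lam d e q t ω) ∂μ := by
  classical
  have := P.isProbabilityMeasure_G
  have hGB : P.G.real B = ∑ x, P.g x * (if x ∈ B then 1 else 0) := by
    have : (B : Set 𝒳) = ↑(Finset.univ.filter (· ∈ B)) := by ext; simp
    rw [congrArg P.G.real this, ← sum_measureReal_singleton, Finset.sum_filter]
    exact Finset.sum_congr rfl fun x _ => by split_ifs <;> simp [Problem.g]
  have hpt : ∀ t ∈ Finset.Icc 1 T, ∀ ω, h / 2 * (P.deviation ρ (q t ω) - P.G.real B) ≤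
      P.subopt ρ (policy L lam d e q t ω) := by
    intro t ht ω
    rw [hGB, Problem.deviation, ← Finset.sum_sub_distrib, Finset.mul_sum]
    refine Finset.sum_le_sum fun x _ => ?_
    rw [← mul_sub, mul_left_comm]
    refine mul_le_mul_of_nonneg_left ?_ (P.g_nonneg x)
    have hterm : ∀ a, 0 ≤ policy L lam d e q t ω x a * (P.meanLoss a x - P.meanLoss (ρ x) x) :=
      fun a => mul_nonneg (H.policy_nonneg ht ω x a) (sub_nonneg.2 (hρ a x))
    -- In `B` the left side is at most `0`. Outside `B` each arm other than `ρ x` costs at least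
    -- `h`, and `π_t ≥ q_t / 2` gives the factor `h / 2`.
    split_ifs with hx
    · have h1 : h / 2 * (1 - q t ω x (ρ x) - 1) ≤ 0 := by
        have := H.q_nonneg ht ω x (ρ x)
        nlinarith
      exact h1.trans (Finset.sum_nonneg fun a _ => hterm a)
    · have h1 : 1 - q t ω x (ρ x) - 0 = ∑ a ∈ Finset.univ.erase (ρ x), q t ω x a := by
        rw [← (H.plays.mem_simplex t ht ω x).2, ← Finset.add_sum_erase _ _ (Finset.mem_univ (ρ x))]
        ring
      rw [h1, Finset.mul_sum]
      refine le_trans (Finset.sum_le_sum fun a ha => ?_)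
        (Finset.sum_le_sum_of_subset_of_nonneg (Finset.erase_subset (ρ x) _) fun a _ _ => hterm a)
      calc h / 2 * q t ω x a = 1 / 2 * q t ω x a * h := by ring
        _ ≤ policy L lam d e q t ω x a * (P.meanLoss a x - P.meanLoss (ρ x) x) :=
          mul_le_mul (H.half_mul_le_policy ht ω x a) (hB x hx a (Finset.ne_of_mem_erase ha)) hh
            (H.policy_nonneg ht ω x a)
  calc _ = ∑ t ∈ Finset.Icc 1 T, h / 2 * (∫ ω, P.deviation ρ (q t ω) ∂μ - P.G.real B) := by
        rw [← Finset.mul_sum, Finset.sum_sub_distrib]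
        simp
    _ ≤ _ := by
        refine Finset.sum_le_sum fun t ht => ?_
        have hi := (H.aebdd_deviation ρ ht).integrable
        have h1 := integral_mono ((hi.sub (integrable_const (P.G.real B))).const_mul (h / 2))
          (H.aebdd_subopt_policy ρ ht).integrable (hpt t ht)
        rw [integral_const_mul] at h1
        simp only [Pi.sub_apply] at h1
        rw [integral_sub hi (integrable_const _)] at h1
        simpa using h1

lemma sum_deviation_le :
    ∑ t ∈ Finset.Icc 1 T, ∫ ω, P.deviation ρ (q t ω) ∂μ ≤ T := by
  calc _ ≤ ∑ t ∈ Finset.Icc 1 T, (1 : ℝ) := by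
        refine Finset.sum_le_sum fun t ht => ?_
        calc _ ≤ ∫ _, (1 : ℝ) ∂μ := integral_mono (H.aebdd_deviation ρ ht).integrable
              (integrable_const _) fun ω => H.deviation_le_one ρ ht ω
          _ = 1 := by simp
    _ = T := by simp

/-- Allows absolute constants to be absorbed into `κ`; it rests on `1 ≤ d ≤ 1 / lam`. -/
lemma one_le_sqrt : 1 ≤ √(K * L / lam) := by
  have hK : (1 : ℝ) ≤ K := by exact_mod_cast H.one_le_K
  have hd : (1 : ℝ) ≤ d := by exact_mod_cast H.one_le_d
  have hL := H.one_le_L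
  have hl := H.lam_pos
  have h1 : 1 ≤ 1 / lam := hd.trans H.natCast_d_le
  rw [Real.one_le_sqrt, mul_div_assoc, div_eq_mul_one_div]
  have : 1 ≤ L * (1 / lam) := one_le_mul_of_one_le_of_one_le hL h1
  exact one_le_mul_of_one_le_of_one_le hK this

lemma kappa_nonneg : 0 ≤ kappa d K L lam T := by
  have hL := H.one_le_L
  have hl := H.lam_pos
  have := Real.log_natCast_nonneg T
  unfold kappa
  positivity

/-- The regret of a single round. -/
lemma regret_one_le (hT : T = 1) (hρ : ∀ a x, P.meanLoss (ρ x) x ≤ P.meanLoss a x) :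
    P.regret μ T X A ε ≤ 2 * kappa d K L lam T := by
  subst hT
  refine (H.regret_le hρ).trans ?_
  have h1 := H.one_le_sqrt
  have ht : (1 : ℕ) ∈ Finset.Icc 1 1 := by simp
  have h2 : ∫ ω, P.subopt ρ (policy L lam d e q 1 ω) ∂μ ≤ 2 := by
    calc _ ≤ ∫ _, (2 : ℝ) ∂μ := by
          refine integral_mono (H.aebdd_subopt_policy ρ ht).integrable (integrable_const _) fun ω => ?_
          have a1 := H.subopt_policy_le ρ ht ω
          have a2 := H.subopt_le_two ρ ht ω
          have a3 := H.rate_le_half (t := 1) le_rfl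
          simp only
          nlinarith
      _ = 2 := by simp
  simp only [Finset.Icc_self, Finset.sum_singleton, kappa, Nat.cast_one, Real.log_one, mul_zero,
    add_zero]
  linarith

/-- The self-bounding upper bound on the regret. -/
lemma upper_bound (hT : 2 ≤ T) (hρ : ∀ a x, P.meanLoss (ρ x) x ≤ P.meanLoss a x)
    {h : ℝ} (hh : 0 < h) :
    ∑ t ∈ Finset.Icc 1 T, ∫ ω, P.subopt ρ (policy L lam d e q t ω) ∂μ ≤
      768 * kappa d K L lam T + h / 8 * ∑ t ∈ Finset.Icc 1 T, ∫ ω, P.deviation ρ (q t ω) ∂μ +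
        800 * (L * d * √K * Real.log T / h) := by
  have hd := H.one_le_d
  have hL := H.one_le_L
  have hl := H.lam_pos
  have hd0 : (0 : ℝ) < d := by exact_mod_cast hd
  set U : ℕ → ℝ := fun t => ∫ ω, √(P.deviation ρ (q t ω)) ∂μ with hU
  set D0 : ℝ := √d * (K : ℝ) ^ (1 / 4 : ℝ) * √L with hD0
  set c : ℝ := √K * L / (lam * d) with hc
  have hc0 : 0 ≤ c := by positivity
  have hD0sq : D0 ^ 2 = L * d * √K := by
    rw [hD0, mul_pow, mul_pow, rpow_quarter_sq, Real.sq_sqrt hd0.le, Real.sq_sqrt (by linarith)]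
    ring
  -- For `T ≥ 2` this turns `1 + log T` into `3 log T`, since `κ` has no separate term for the `1`.
  have hlog : 1 / 2 ≤ Real.log T := by
    have h1 : Real.log 2 ≤ Real.log T := Real.log_le_log (by norm_num) (by exact_mod_cast hT)
    linarith [Real.log_two_gt_d9]
  have hharm := sum_one_div_le_one_add_log T
  have hIoc : Finset.Ioc 1 T = Finset.Icc 2 T := by
    ext t
    simp only [Finset.mem_Ioc, Finset.mem_Icc]
    omega
  have hharm2 : ∑ t ∈ Finset.Icc 2 T, 1 / (t : ℝ) ≤ Real.log T := by
    rw [← Finset.add_sum_Ioc_eq_sum_Icc (by omega : 1 ≤ T), hIoc] at hharm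
    simp only [Nat.cast_one, div_one] at hharm
    linarith
  have b1 : ∑ t ∈ Finset.Icc 1 T, ∫ ω, P.subopt ρ (policy L lam d e q t ω) ∂μ ≤
      ∑ t ∈ Finset.Icc 1 T, ∫ ω, P.subopt ρ (q t ω) ∂μ + 768 * (c * Real.log T) := by
    have h1 : ∀ t ∈ Finset.Icc 1 T, ∫ ω, P.subopt ρ (policy L lam d e q t ω) ∂μ ≤
        ∫ ω, P.subopt ρ (q t ω) ∂μ + 256 * c * (1 / t) := by
      intro t ht
      have ht1 := (Finset.mem_Icc.1 ht).1
      have h2 : ∀ ω, P.subopt ρ (policy L lam d e q t ω) ≤ P.subopt ρ (q t ω) + 256 * c * (1 / t) := by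
        intro ω
        have a1 := H.subopt_policy_le ρ ht ω
        have a2 := explorationRate_le hd H.one_le_K hL hl ht1
        have a3 := H.rate_pos ht1
        have a4 : 0 ≤ P.subopt ρ (q t ω) := Finset.sum_nonneg fun x _ =>
          mul_nonneg (P.g_nonneg x) (Finset.sum_nonneg fun a _ =>
            mul_nonneg (H.q_nonneg ht ω x a) (sub_nonneg.2 (hρ a x)))
        rw [← hc] at a2
        nlinarith
      have h3 := integral_mono (H.aebdd_subopt_policy ρ ht).integrable
        ((H.aebdd_subopt ρ ht).integrable.add (integrable_const (256 * c * (1 / (t : ℝ))))) h2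
      simp only [Pi.add_apply] at h3
      rw [integral_add (H.aebdd_subopt ρ ht).integrable (integrable_const _)] at h3
      simpa using h3
    refine (Finset.sum_le_sum h1).trans ?_
    rw [Finset.sum_add_distrib, ← Finset.mul_sum]
    have h4 : 256 * c * ∑ t ∈ Finset.Icc 1 T, 1 / (t : ℝ) ≤ 256 * c * (3 * Real.log T) := by
      gcongr
      linarith
    linarith
  have b2 : ∑ t ∈ Finset.Icc 1 T, ∫ ω, P.subopt ρ (q t ω) ∂μ ≤ 40 * √(K * L / lam) +
      ∑ t ∈ Finset.Icc 2 T, 20 * D0 / √t * U t := by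
    -- FTRL over `n` rounds uses `q_{n+1}`, and minimizers are given only up to round `T`; the last
    -- round is bounded by `2`.
    obtain ⟨n, rfl⟩ : ∃ n, T = n + 1 := ⟨T - 1, by omega⟩
    rw [Finset.sum_Icc_succ_top (by omega)]
    have h1 := H.sum_integral_subopt_le ρ (n := n) (by omega) le_rfl
    have ht : n + 1 ∈ Finset.Icc 1 (n + 1) := Finset.mem_Icc.2 (by omega)
    have h2 : ∫ ω, P.subopt ρ (q (n + 1) ω) ∂μ ≤ 2 := by
      calc _ ≤ ∫ _, (2 : ℝ) ∂μ := integral_mono (H.aebdd_subopt ρ ht).integrable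
            (integrable_const _) fun ω => H.subopt_le_two ρ ht ω
        _ = 2 := by simp
    have h3 := H.one_le_sqrt
    linarith
  have b3 : ∑ t ∈ Finset.Icc 2 T, 20 * D0 / √t * U t ≤
      h / 8 * ∑ t ∈ Finset.Icc 1 T, ∫ ω, P.deviation ρ (q t ω) ∂μ +
        800 * (L * d * √K * Real.log T / h) := by
    have h1 : ∀ t ∈ Finset.Icc 2 T, 20 * D0 / √t * U t ≤
        h / 8 * ∫ ω, P.deviation ρ (q t ω) ∂μ + 800 * D0 ^ 2 / h * (1 / t) := by
      intro t ht
      have ht0 : 2 ≤ t := (Finset.mem_Icc.1 ht).1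
      have ht' : t ∈ Finset.Icc 1 T := by
        rw [Finset.mem_Icc] at *
        omega
      have htpos : (0 : ℝ) < t := by exact_mod_cast (by omega : 0 < t)
      -- Young's inequality; the weight `h / 8` is a quarter of the `h / 2` in the lower bound, so
      -- it can be absorbed later.
      have h2 : ∀ ω, 20 * D0 / √t * √(P.deviation ρ (q t ω)) ≤
          h / 8 * P.deviation ρ (q t ω) + 800 * D0 ^ 2 / h * (1 / t) := by
        intro ω
        have a1 := Real.sq_sqrt (H.deviation_nonneg ρ ht' ω)
        have a2 := Real.sq_sqrt htpos.le
        have a3 := Real.sqrt_pos.2 htpos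
        set y := √(P.deviation ρ (q t ω))
        set s := √(t : ℝ)
        rw [← a1, ← a2]
        have a4 : h / 8 * y ^ 2 + 800 * D0 ^ 2 / h * (1 / s ^ 2) - 20 * D0 / s * y =
            (h * s * y - 80 * D0) ^ 2 / (8 * h * s ^ 2) := by
          field_simp
          ring
        have a5 : 0 ≤ (h * s * y - 80 * D0) ^ 2 / (8 * h * s ^ 2) := by positivity
        linarith
      have hi := (H.aebdd_deviation ρ ht').integrable
      have h3 := integral_mono ((H.aebdd_deviation ρ ht').sqrt.const_mul _).integrable
        ((hi.const_mul (h / 8)).add (integrable_const (800 * D0 ^ 2 / h * (1 / (t : ℝ))))) h2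
      simp only [Pi.add_apply] at h3
      rw [integral_add (hi.const_mul _) (integrable_const _), integral_const_mul,
        integral_const_mul] at h3
      simpa using h3
    refine (Finset.sum_le_sum h1).trans ?_
    rw [Finset.sum_add_distrib, ← Finset.mul_sum, ← Finset.mul_sum]
    refine add_le_add ?_ ?_
    · refine mul_le_mul_of_nonneg_left ?_ (by positivity)
      refine Finset.sum_le_sum_of_subset_of_nonneg (Finset.Icc_subset_Icc_left (by omega))
        fun t ht _ => integral_nonneg fun ω => H.deviation_nonneg ρ ht ω
    · calc 800 * D0 ^ 2 / h * ∑ t ∈ Finset.Icc 2 T, 1 / (t : ℝ)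
          ≤ 800 * D0 ^ 2 / h * Real.log T := by gcongr
        _ = _ := by rw [hD0sq]; ring
  have b4 : 40 * √(K * L / lam) + 768 * (c * Real.log T) ≤ 768 * kappa d K L lam T := by
    have := Real.sqrt_nonneg (K * L / lam)
    rw [kappa, ← hc]
    linarith
  linarith

end IsRun

end LinearContextualBandit

/-! ### The theorem -/

theorem theorem4p3 :
    ∃ C : ℝ, 0 < C ∧
      ∀ (𝒳 Ω : Type*) [Fintype 𝒳] [MeasurableSpace 𝒳] [MeasurableSingletonClass 𝒳]
        [MeasurableSpace Ω] (μ : Measure Ω) [IsProbabilityMeasure μ]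
        (d K T : ℕ) (_ : 1 ≤ d) (_ : 1 ≤ T)
        (P : LinearContextualBandit.Problem 𝒳 d K)
        (L lam : ℝ) (e : 𝒳 → Fin K → ℝ)
        (_ : P.FiniteSupport L) (_ : P.IsExplorationPolicy lam e)
        (X : ℕ → Ω → 𝒳) (A : ℕ → Ω → Fin K) (ε : ℕ → Fin K → Ω → ℝ)
        (_ : P.IsStochasticEnvironment μ T X A ε)
        (q : ℕ → Ω → 𝒳 → Fin K → ℝ)
        (_ : P.PlaysLCTsallisINF (1 / 2) L lam e μ T q X A ε)
        (ρ : 𝒳 → Fin K) (_ : P.IsOptimalPolicy μ T X ρ)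
        (Δs : ℝ) (β : ℝ≥0∞) (_ : P.MarginCondition ρ Δs β),
        (β ≠ ⊤ →
          P.regret μ T X A ε ≤
            C * (((1 + β.toReal) / (β.toReal * Δs)) ^ (β.toReal / (2 + β.toReal)) *
                  (L * d * √K * Real.log T) ^ ((1 + β.toReal) / (2 + β.toReal)) *
                  (T : ℝ) ^ (1 / (2 + β.toReal)) +
                LinearContextualBandit.kappa d K L lam T)) ∧
        (β = ⊤ →
          P.regret μ T X A ε ≤
            C * (L * d * √K * Real.log T / Δs + LinearContextualBandit.kappa d K L lam T)) := by
  refine ⟨1100, by norm_num, ?_⟩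
  intro 𝒳 Ω _ _ _ _ μ _ d K T hd hT P L lam e hS he X A ε hE q hq ρ hopt Δs β hM
  have H : LinearContextualBandit.IsRun P L lam e μ T q X A ε := ⟨hd, hS, he, hE, hq⟩
  have hρ := H.meanLoss_le_of_isOptimalPolicy hT hopt
  have hκ := H.kappa_nonneg
  have hΔ := hM.Δs_pos
  have hL := H.one_le_L
  have hlog := Real.log_natCast_nonneg T
  have hreg := H.regret_le hρ
  have hgap : ∀ x a, a ≠ ρ x → P.gap ρ x ≤ ((P.meanLoss a x - P.meanLoss (ρ x) x : ℝ) : EReal) :=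
    fun x a ha => iInf_le (fun a : {a : Fin K // a ≠ ρ x} =>
      ((P.φ a.1 x ⬝ᵥ P.θ₀ - P.φ (ρ x) x ⬝ᵥ P.θ₀ : ℝ) : EReal)) ⟨a, ha⟩
  -- For `T = 1` the logarithm vanishes and there is no `D > 0` to balance with; `κ` alone covers
  -- the regret.
  rcases hT.eq_or_lt with hT1 | hT2
  · have h1 := H.regret_one_le hT1.symm hρ
    refine ⟨fun _ => ?_, fun _ => ?_⟩
    · refine h1.trans (mul_le_mul (by norm_num) (le_add_of_nonneg_left ?_) hκ (by norm_num))
      have : 0 ≤ β.toReal := ENNReal.toReal_nonneg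
      positivity
    · refine h1.trans (mul_le_mul (by norm_num) (le_add_of_nonneg_left ?_) hκ (by norm_num))
      positivity
  · have hK : (0 : ℝ) < K := by exact_mod_cast H.one_le_K
    have hd0 : (0 : ℝ) < d := by exact_mod_cast hd
    have hlog0 : 0 < Real.log T := Real.log_pos (by exact_mod_cast hT2)
    have hD : 0 < L * d * √K * Real.log T := by positivity
    have hup := fun (h : ℝ) (hh : 0 < h) => H.upper_bound hT2 hρ hh
    refine ⟨fun hβ => hreg.trans ?_, fun hβ => hreg.trans ?_⟩
    · refine LinearContextualBandit.selfBounding_le (by exact_mod_cast hT) hD hκ hΔ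
        (ENNReal.toReal_pos hM.β_pos.ne' hβ) H.sum_deviation_le hup fun h hh hle => ?_
      refine le_trans ?_ (H.lower_bound hh.le hρ {x | P.gap ρ x ≤ (h : EReal)} fun x hx a ha => ?_)
      · have := hM.finite hβ h ⟨hh.le, hle⟩
        gcongr
      · have h1 : (h : EReal) < P.gap ρ x := not_le.1 hx
        exact (EReal.coe_lt_coe_iff.1 (h1.trans_le (hgap x a ha))).le
    -- Every context has positive mass, so the null set of contexts with gap below `Δs` is empty and
    -- `h = Δs` works with no exceptional set.
    · have hlow := H.lower_bound hΔ.le hρ ∅ fun x _ a ha => by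
        by_contra! hlt
        have h1 : P.gap ρ x < (Δs : EReal) :=
          (hgap x a ha).trans_lt (EReal.coe_lt_coe_iff.2 hlt)
        have h2 : P.G {x} = 0 := measure_mono_null (Set.singleton_subset_iff.2 h1) (hM.infinite hβ)
        exact (H.g_pos x).ne' (by simp [LinearContextualBandit.Problem.g, Measure.real, h2])
      simp only [measureReal_empty, mul_zero, sub_zero] at hlow
      have h3 := hup Δs hΔ
      have h4 : 0 < L * d * √K * Real.log T / Δs := by positivity
      linarith
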